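/- Let $p$ be a probability distribution on $\mathbb{R}$ with mean $0$, variance $1$ and all moments finite, and let $b_0,b_1,b_2,\dots$ be independent with law $p$. Let $A_N$ be the $N\times N$ random real symmetric Toeplitz matrix with zero main diagonal and $(i,j)$ entry $b_{|i-j|}$ for $i\neq j$, and let $\lambda_1,\dots,\lambda_N$ be its eigenvalues. Put $$M_m(N)=\mathbb{E}\Big[\frac1N\sum_{i=1}^N\Big(\frac{\lambda_i}{\sqrt N}\Big)^m\Big].$$ A pairing of $2k$ is a fixed-point-free involution $\pi$ of $\{1,\dots,2k\}$; for $k\ge1$ there are $(2k-1)!!$ of them (with the convention $(-1)!!=1$). Indices are read cyclically modulo $2k$. For a pairing $\pi$ consider the equations $$i_a-i_{a+1}=-(i_{\pi(a)}-i_{\pi(a)+1})\qquad(1\le a\le 2k).\tag{$*$}$$ The contribution of $\pi$ is $v(\pi)=\lim_{N\to\infty}N^{-(k+1)}\,\#\{(i_1,\dots,i_{2k})\in\{1,\dots,N\}^{2k}:(*)\}$. We say that $\pi$ carries at least $c$ independent Diophantine obstructions if there are positions $a_1,\dots,a_c$, with partners $q_s=\pi(a_s)$, such that in the $c$ relations $i_{a_s}=i_{a_s+1}+i_{q_s+1}-i_{q_s}$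 the $3c$ indices on the right-hand sides are independent free variables, i.e. linearly independent as linear functionals on the space of real solutions of $(*)$. **Theorem.** For every $k\ge0$ the limit $M_{2k}=\lim_{N\to\infty}M_{2k}(N)$ exists and does not depend on $p$, and $$\lim_{k\to\infty}\frac{M_{2k}}{(2k-1)!!}=0.$$ Moreover: 1. the limit $v(\pi)$ exists for every pairing $\pi$, and $M_{2k}=\sum_\pi v(\pi)$ for all $k\ge1$, the sum running over all pairings of $2k$; 2. for every fixed $c$, the proportion of the $(2k-1)!!$ pairings of $2k$ that carry at least $c$ independent Diophantine obstructions tends to $1$ as $k\to\infty$; 3. every pairing $\pi$ that carries at least $c$ independent Diophantine obstructions satisfies $v(\pi)\le(2/3)^c$. -/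

import Mathlib

open MeasureTheory Filter Topology
open scoped Nat ENNReal

noncomputable section

namespace RandomToeplitz

/-- The `N × N` real symmetric Toeplitz matrix with vanishing main diagonal, whose `(i, j)` entry
is `b_{|i - j|}` for `i ≠ j`. It is the upper left `N × N` block of the infinite matrix
attached to the sequence `b`; the value `b 0` is not used. -/
def toeplitz (N : ℕ) (b : ℕ → ℝ) : Matrix (Fin N) (Fin N) ℝ :=
  Matrix.of fun i j => if i = j then 0 else b ((i : ℤ) - (j : ℤ)).natAbs

theorem toeplitz_isHermitian (N : ℕ) (b : ℕ → ℝ) : (toeplitz N b).IsHermitian := by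
  ext i j
  have h : ((j : ℤ) - (i : ℤ)).natAbs = ((i : ℤ) - (j : ℤ)).natAbs := by omega
  simp only [toeplitz, Matrix.conjTranspose_apply, Matrix.of_apply, star_trivial, h,
    eq_comm (a := j) (b := i)]

/-- The normalized spectral measure: a mass `1 / N` at each `λ_i / √N`, where
`λ_1, …, λ_N` are the eigenvalues (with multiplicity) of the Toeplitz matrix of `b`. -/
def spectralMeasure (N : ℕ) (b : ℕ → ℝ) : Measure ℝ :=
  (N : ℝ≥0∞)⁻¹ • ∑ i : Fin N,
    Measure.dirac ((toeplitz_isHermitian N b).eigenvalues i / Real.sqrt N)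

/-- `M_m(A, N)`: the `m`-th moment of the normalized spectral measure. -/
def spectralMoment (m N : ℕ) (b : ℕ → ℝ) : ℝ :=
  ∫ x, x ^ m ∂(spectralMeasure N b)

/-- `M_m(N)`: the average of `M_m(A, N)` over the ensemble in which the `b_j` are independent
with common law `p`. -/
def averageMoment (p : Measure ℝ) [IsProbabilityMeasure p] (m N : ℕ) : ℝ :=
  ∫ b, spectralMoment m N b ∂(Measure.infinitePi fun _ : ℕ => p)

/-- A pairing of the `2 * k` positions `0, …, 2k - 1` (position `a` stands for the factor
`b_{|i_a - i_{a+1}|}` in the cyclic product), as a fixed-point-free involution. -/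
abbrev Pairing (k : ℕ) : Type :=
  {σ : Equiv.Perm (Fin (2 * k)) // ∀ a, σ (σ a) = a ∧ σ a ≠ a}

/-- The cyclic successor `a ↦ a + 1` modulo `2 * k`. -/
abbrev next {k : ℕ} (a : Fin (2 * k)) : Fin (2 * k) := finRotate (2 * k) a

/-- The index tuples `(i_a)` with entries in `{1, …, N}` whose cyclic differences are
matched by `π` with opposite signs: `i_a - i_{a+1} = -(i_b - i_{b+1})` if `π` pairs `a` and `b`.
The element `j : Fin N` stands for the index `j + 1`. -/
def matchedTuples {k : ℕ} (π : Pairing k) (N : ℕ) : Finset (Fin (2 * k) → Fin N) :=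
  {i | ∀ a, ((i a : ℕ) : ℤ) - ((i (next a) : ℕ) : ℤ)
    = -(((i (π.1 a) : ℕ) : ℤ) - ((i (next (π.1 a)) : ℕ) : ℤ))}

/-- The normalized contribution of the pairing `π` to `M_{2k}(N)`. -/
def contribution {k : ℕ} (π : Pairing k) (N : ℕ) : ℝ :=
  ((matchedTuples π N).card : ℝ) / (N : ℝ) ^ (k + 1)

/-- The real solution space of the linear equations `x_a - x_{a+1} = -(x_b - x_{b+1})`, one for
each pair `{a, b}` of `π`. -/
def solutionSpace {k : ℕ} (π : Pairing k) : Submodule ℝ (Fin (2 * k) → ℝ) where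
  carrier := {x | ∀ a, x a - x (next a) = -(x (π.1 a) - x (next (π.1 a)))}
  zero_mem' := by intro a; simp
  add_mem' := by
    intro x y hx hy a
    have h₁ := hx a
    have h₂ := hy a
    simp only [Pi.add_apply]
    linarith
  smul_mem' := by
    intro r x hx a
    have h₁ := hx a
    simp only [Pi.smul_apply, smul_eq_mul, ← mul_sub, h₁, mul_neg]

/-- The index `x_a`, as a linear function on the solution space of `π`. -/
def index {k : ℕ} (π : Pairing k) (a : Fin (2 * k)) : solutionSpace π →ₗ[ℝ] ℝ :=
  (LinearMap.proj a).comp (solutionSpace π).subtype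

/-- `π` carries (at least) `c` independent Diophantine obstructions: there are positions
`a_1, …, a_c`, with partners `b_s = π(a_s)`, such that in the `c` relations
`i_{a_s} = i_{a_s + 1} + i_{b_s + 1} - i_{b_s}` all the `3c` indices on the
right are independent free variables. (Each relation obstructs because `i_{a_s}` must lie in
`{1, …, N}` as well. The independence forces the `c` pairs `{a_s, b_s}` to be distinct.) -/
def HasObstructions {k : ℕ} (π : Pairing k) (c : ℕ) : Prop :=
  ∃ a : Fin c → Fin (2 * k),
    LinearIndependent ℝ fun t : Fin c × Fin 3 =>
      (![index π (next (a t.1)), index π (next (π.1 (a t.1))), index π (π.1 (a t.1))] :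
        Fin 3 → (solutionSpace π →ₗ[ℝ] ℝ)) t.2

end RandomToeplitz

end

noncomputable section

namespace RandomToeplitz

/-! Moments become counts. The trace formula writes the $2k$-th moment as an average over closed
tuples of expected products of entries. Up to $O(N^k)$ degenerate tuples, a tuple has expectation
$1$ if exactly one pairing matches its differences with opposite signs, and $0$ if none does
(`tupleExpectation_eq_matchCount`, `exists_card_degenerateTuples_le`). Hence the normalized moment
is asymptotic to $\sum_\pi$ `contribution π N`, whatever the law $p$. Each contribution counts
lattice points of mesh $1/N$ in a bounded convex region with $k+1$ parameters, so it converges to a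
volume.

For the decay, an obstruction asks that $x+y-z$ stay in range for three free indices, which has
limiting probability $2/3$. Independent obstructions multiply (`card_matchedTuples_le`).

Most pairings have many obstructions. Cut the positions into $6c$ blocks of length proportional to
$k$. Three suitable chords among six consecutive blocks yield one obstruction independent of those
in the other groups of six (`hasObstructions_of_chords`). A switching argument shows that a given
pair of long blocks is joined by a chord in all but a proportion $O(1/k)$ of pairings
(`card_unlinked_mul_le`). -/

theorem val_next {k : ℕ} (a : Fin (2 * k)) :
    (next a).val = if a.val + 1 = 2 * k then 0 else a.val + 1 := by
  unfold next
  generalize 2 * k = n at a ⊢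
  cases n with
  | zero => exact a.elim0
  | succ n =>
    rw [coe_finRotate]
    simp only [Fin.ext_iff, Fin.val_last, Nat.add_right_cancel_iff]

theorem next_val_of_lt {k : ℕ} (a : Fin (2 * k)) (h : a.val + 1 < 2 * k) :
    (next a).val = a.val + 1 := by
  rw [val_next, if_neg h.ne]

theorem Pairing.apply_apply {k : ℕ} (π : Pairing k) (a : Fin (2 * k)) : π.1 (π.1 a) = a :=
  (π.2 a).1

theorem Pairing.apply_ne {k : ℕ} (π : Pairing k) (a : Fin (2 * k)) : π.1 a ≠ a :=
  (π.2 a).2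

/-! ### The number of pairings -/

/-- Pairings are the permutations of cycle type $2^k$, whose number is $(2k)!/(2^k k!)$, and $2^k k!
= (2k)!!$. -/
theorem card_pairing (k : ℕ) : Fintype.card (Pairing k) = (2 * k - 1)‼ := by
  have key : ∀ σ : Equiv.Perm (Fin (2 * k)),
      (∀ a, σ (σ a) = a ∧ σ a ≠ a) ↔ σ.cycleType = Multiset.replicate k 2 := by
    intro σ
    constructor
    · intro h
      have h2 : σ ^ 2 = 1 := by
        ext a
        simp [pow_two, (h a).1]
      have h3 := Equiv.Perm.cycleType_of_pow_prime_eq_one (p := 2) h2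
      have h4 := σ.sum_cycleType
      have h5 : σ.support = Finset.univ := by
        ext a
        simp [(h a).2]
      rw [h3, h5, Multiset.sum_replicate, Finset.card_univ, Fintype.card_fin, smul_eq_mul] at h4
      rw [h3]
      congr 1
      omega
    · intro h a
      have h2 : σ ^ 2 = 1 := by
        rw [Equiv.Perm.pow_prime_eq_one_iff (p := 2), h]
        intro c hc
        exact Multiset.eq_of_mem_replicate hc
      have h4 := σ.sum_cycleType
      rw [h, Multiset.sum_replicate, smul_eq_mul] at h4
      have h5 : σ.support = Finset.univ := by
        apply Finset.eq_univ_of_card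
        rw [Fintype.card_fin]
        omega
      refine ⟨?_, ?_⟩
      · have := Equiv.congr_fun h2 a
        simpa [pow_two] using this
      · have : a ∈ σ.support := by rw [h5]; exact Finset.mem_univ a
        simpa using this
  have hc : Fintype.card (Pairing k) =
      (Finset.univ.filter fun σ : Equiv.Perm (Fin (2 * k)) =>
        σ.cycleType = Multiset.replicate k 2).card := by
    rw [Fintype.card_subtype]
    congr 1
    ext σ
    simp only [Finset.mem_filter, Finset.mem_univ, true_and]
    exact key σ
  have h := Equiv.Perm.card_of_cycleType_mul_eq (Fin (2 * k)) (Multiset.replicate k 2)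
  rw [← hc, if_pos, Multiset.sum_replicate, Multiset.prod_replicate, Fintype.card_fin,
    smul_eq_mul, mul_comm k 2, Nat.sub_self, Nat.factorial_zero, one_mul] at h
  · rcases Nat.eq_zero_or_pos k with rfl | hk
    · simpa using h
    · rw [Multiset.toFinset_replicate, if_neg hk.ne', Finset.prod_singleton,
        Multiset.count_replicate_self, ← Nat.doubleFactorial_two_mul] at h
      have h2 := Nat.factorial_eq_mul_doubleFactorial (2 * k - 1)
      rw [Nat.sub_add_cancel (by omega)] at h2
      rw [h2, mul_comm (2 * k)‼] at h
      exact Nat.eq_of_mul_eq_mul_right (Nat.doubleFactorial_pos _) h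
  · refine ⟨by simp [mul_comm], fun a ha => (Multiset.eq_of_mem_replicate ha).ge⟩

/-! ### Obstructions from chords between blocks -/

/-- The solution attached to a chord `{a, π a}` with `a < π a`: the indicator of `(a, π a]`. -/
def chordSolution {k : ℕ} (π : Pairing k) (a : Fin (2 * k)) (h : a < π.1 a) : solutionSpace π :=
  ⟨fun x => if a < x ∧ x ≤ π.1 a then 1 else 0, by
    have step : ∀ x : Fin (2 * k), ((if a < x ∧ x ≤ π.1 a then 1 else 0 : ℝ)
        - (if a < next x ∧ next x ≤ π.1 a then 1 else 0))
        = (if x = π.1 a then 1 else 0) - (if x = a then 1 else 0) := by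
      intro x
      have h1 := val_next x
      have h2 := x.2
      have h3 := (π.1 a).2
      simp only [Fin.lt_def, Fin.le_def, Fin.ext_iff] at h ⊢
      rw [h1]
      split_ifs <;> first | omega | norm_num
    intro x
    simp only [step]
    have e1 : π.1 x = π.1 a ↔ x = a := π.1.injective.eq_iff
    have e2 : π.1 x = a ↔ x = π.1 a := by
      constructor
      · rintro rfl; exact (π.apply_apply x).symm
      · rintro rfl; exact π.apply_apply a
    simp only [e1, e2]
    ring⟩

theorem index_chordSolution {k : ℕ} (π : Pairing k) (a : Fin (2 * k)) (h : a < π.1 a)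
    (x : Fin (2 * k)) :
    index π x (chordSolution π a h) = if a < x ∧ x ≤ π.1 a then 1 else 0 := rfl

/-- The `i`-th of the consecutive blocks of length `m`. -/
def block (k m i : ℕ) : Finset (Fin (2 * k)) :=
  Finset.univ.filter fun x => i * m ≤ x.val ∧ x.val < (i + 1) * m

theorem mem_block {k m i : ℕ} {x : Fin (2 * k)} :
    x ∈ block k m i ↔ i * m ≤ x.val ∧ x.val < (i + 1) * m := by
  simp [block]

theorem card_block {k m i : ℕ} (h : (i + 1) * m ≤ 2 * k) : (block k m i).card = m := by
  have : (block k m i).map Fin.valEmbedding = Finset.Ico (i * m) ((i + 1) * m) := by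
    ext x
    simp only [Finset.mem_map, mem_block, Fin.valEmbedding_apply, Finset.mem_Ico]
    constructor
    · rintro ⟨y, hy, rfl⟩; exact hy
    · intro hx
      exact ⟨⟨x, by omega⟩, hx, rfl⟩
  rw [← Finset.card_map, this, Nat.card_Ico]
  have : (i + 1) * m = i * m + m := by ring
  omega

theorem disjoint_block {k m i j : ℕ} (h : i < j) : Disjoint (block k m i) (block k m j) := by
  rw [Finset.disjoint_left]
  intro x hx hy
  rw [mem_block] at hx hy
  have := Nat.mul_le_mul_right m (show i + 1 ≤ j by omega)
  omega

/-- Each $s$ owns six consecutive blocks, and chord solutions supported there vanish at the indices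
of every other $s$. With $q = \pi(a)$, the chords $u$, $w$, $a$ evaluate the indices $(a+1, q+1, q)$
to $(1,0,0)$, $(0,1,1)$, $(1,0,1)$. This matrix is invertible, so all three coefficients vanish. -/
theorem hasObstructions_of_chords {k : ℕ} (π : Pairing k) (c m : ℕ) (hm : 6 * c * m ≤ 2 * k)
    (ha : ∀ s < c, ∃ a ∈ block k m (6 * s + 1), π.1 a ∈ block k m (6 * s + 4))
    (hu : ∀ s < c, ∃ a ∈ block k m (6 * s), π.1 a ∈ block k m (6 * s + 2))
    (hw : ∀ s < c, ∃ a ∈ block k m (6 * s + 3), π.1 a ∈ block k m (6 * s + 5)) :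
    HasObstructions π c := by
  have ha' : ∀ s : Fin c, ∃ a, a ∈ block k m (6 * s + 1) ∧ π.1 a ∈ block k m (6 * s + 4) :=
    fun s => ha s s.2
  have hu' : ∀ s : Fin c, ∃ a, a ∈ block k m (6 * s) ∧ π.1 a ∈ block k m (6 * s + 2) :=
    fun s => hu s s.2
  have hw' : ∀ s : Fin c, ∃ a, a ∈ block k m (6 * s + 3) ∧ π.1 a ∈ block k m (6 * s + 5) :=
    fun s => hw s s.2
  choose a ha1 ha2 using ha'
  choose u hu1 hu2 using hu'
  choose w hw1 hw2 using hw'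
  simp only [mem_block] at ha1 ha2 hu1 hu2 hw1 hw2
  refine ⟨a, ?_⟩
  set A : Fin c → ℕ := fun s => 6 * s * m with hA
  have hblk : ∀ (s : Fin c) (j : ℕ), (6 * (s : ℕ) + j) * m = A s + j * m := by
    intro s j; simp only [hA]; ring
  have hblk' : ∀ (s : Fin c) (j : ℕ), (6 * (s : ℕ) + j + 1) * m = A s + j * m + m := by
    intro s j; simp only [hA]; ring
  have hblk0 : ∀ (s : Fin c), (6 * (s : ℕ) + 1) * m = A s + m := by
    intro s; simp only [hA]; ring
  have hblk1 : ∀ (s : Fin c), (6 * (s : ℕ)) * m = A s := fun s => rfl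
  simp only [hblk', hblk] at ha1 ha2 hw1 hw2 hu2
  simp only [hblk0, hblk1] at hu1
  have hend : ∀ s : Fin c, A s + 6 * m ≤ 2 * k := by
    intro s
    have h1 : (6 * (s : ℕ) + 6) * m ≤ 6 * c * m := Nat.mul_le_mul_right m (by omega)
    rw [hblk] at h1
    omega
  have hsep : ∀ s t : Fin c, s < t → A s + 6 * m ≤ A t := by
    intro s t hst
    have hst' : (s : ℕ) < t := hst
    have h1 : (6 * (s : ℕ) + 6) * m ≤ 6 * t * m := Nat.mul_le_mul_right m (by omega)
    rw [hblk] at h1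
    exact h1
  have hna : ∀ s, (next (a s)).val = (a s).val + 1 := by
    intro s
    apply next_val_of_lt
    have := hend s; have := ha1 s
    omega
  have hnq : ∀ s, (next (π.1 (a s))).val = (π.1 (a s)).val + 1 := by
    intro s
    apply next_val_of_lt
    have := hend s; have := ha2 s
    omega
  have hua : ∀ s, u s < π.1 (u s) := by
    intro s
    rw [Fin.lt_def]
    have := hu1 s; have := hu2 s
    omega
  have hwa : ∀ s, w s < π.1 (w s) := by
    intro s
    rw [Fin.lt_def]
    have := hw1 s; have := hw2 s
    omega
  have haa : ∀ s, a s < π.1 (a s) := by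
    intro s
    rw [Fin.lt_def]
    have := ha1 s; have := ha2 s
    omega
  rw [Fintype.linearIndependent_iff]
  intro g hg
  have hev : ∀ y : solutionSpace π, ∑ s : Fin c,
      (g (s, 0) * index π (next (a s)) y + g (s, 1) * index π (next (π.1 (a s))) y
        + g (s, 2) * index π (π.1 (a s)) y) = 0 := by
    intro y
    have := LinearMap.congr_fun hg y
    rw [LinearMap.sum_apply, Fintype.sum_prod_type] at this
    simpa [Fin.sum_univ_three] using this
  have trip : ∀ s t : Fin c, s ≠ t → A s + 6 * m ≤ A t ∨ A t + 6 * m ≤ A s := by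
    intro s t hst
    rcases lt_or_gt_of_ne hst with h | h
    · exact Or.inl (hsep s t h)
    · exact Or.inr (hsep t s h)
  -- a chord within the gadget of `s` sees only the three indices of that gadget
  have loc : ∀ (s : Fin c) (x : Fin (2 * k)) (hx : x < π.1 x), A s ≤ x.val →
      (π.1 x).val < A s + 6 * m →
      g (s, 0) * index π (next (a s)) (chordSolution π x hx)
        + g (s, 1) * index π (next (π.1 (a s))) (chordSolution π x hx)
        + g (s, 2) * index π (π.1 (a s)) (chordSolution π x hx) = 0 := by
    intro s x hx h1 h2
    rw [← hev (chordSolution π x hx)]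
    symm
    apply Finset.sum_eq_single s
    · intro t _ hts
      have h3 := trip t s hts
      have h4 := ha1 t
      have h5 := ha2 t
      simp only [index_chordSolution, Fin.lt_def, Fin.le_def, hna, hnq]
      rw [if_neg (by omega), if_neg (by omega), if_neg (by omega)]
      ring
    · intro h; exact absurd (Finset.mem_univ s) h
  have main : ∀ s, g (s, 0) = 0 ∧ g (s, 1) = 0 ∧ g (s, 2) = 0 := by
    intro s
    have a1 := ha1 s
    have a2 := ha2 s
    have u1 := hu1 s
    have u2 := hu2 s
    have w1 := hw1 s
    have w2 := hw2 s
    have e1 := loc s (u s) (hua s) (by omega) (by omega)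
    have e2 := loc s (w s) (hwa s) (by omega) (by omega)
    have e3 := loc s (a s) (haa s) (by omega) (by omega)
    simp only [index_chordSolution, Fin.lt_def, Fin.le_def, hna, hnq] at e1 e2 e3
    rw [if_pos (by omega), if_neg (by omega), if_neg (by omega)] at e1
    rw [if_neg (by omega), if_pos (by omega), if_pos (by omega)] at e2
    rw [if_pos (by omega), if_neg (by omega), if_pos (by omega)] at e3
    refine ⟨by linarith, by linarith, by linarith⟩
  rintro ⟨s, j⟩
  obtain ⟨h0, h1, h2⟩ := main s
  fin_cases j
  · exact h0
  · exact h1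
  · exact h2

/-! ### Switching: almost all pairings carry many obstructions -/

/-- The pairing with the chords `{a, π a}`, `{b, π b}` replaced by `{a, b}`, `{π a, π b}`. -/
def switch {k : ℕ} (π : Pairing k) (a b : Fin (2 * k)) : Pairing k :=
  ⟨Equiv.swap (π.1 a) b * π.1 * Equiv.swap (π.1 a) b, by
    intro x
    simp only [Equiv.Perm.mul_apply, Equiv.swap_apply_self, π.apply_apply, true_and]
    intro h
    have h' := congrArg (Equiv.swap (π.1 a) b) h
    rw [Equiv.swap_apply_self] at h'
    exact π.apply_ne _ h'⟩

theorem switch_apply {k : ℕ} (π : Pairing k) (a b x : Fin (2 * k)) :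
    (switch π a b).1 x = Equiv.swap (π.1 a) b (π.1 (Equiv.swap (π.1 a) b x)) := rfl

theorem switch_apply_left {k : ℕ} (π : Pairing k) {a b : Fin (2 * k)} (h : a ≠ b) :
    (switch π a b).1 a = b := by
  rw [switch_apply, Equiv.swap_apply_of_ne_of_ne (π.apply_ne a).symm h, Equiv.swap_apply_left]

/-- Pairings without a chord between `I` and `J`. -/
def unlinked {k : ℕ} (I J : Finset (Fin (2 * k))) : Finset (Pairing k) :=
  Finset.univ.filter fun π => ∀ a ∈ I, π.1 a ∉ J

theorem mem_unlinked {k : ℕ} {I J : Finset (Fin (2 * k))} {π : Pairing k} :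
    π ∈ unlinked I J ↔ ∀ a ∈ I, π.1 a ∉ J := by
  simp [unlinked]

/-- The switch changes the partners of $a$, $\pi(a)$, $b$, $\pi(b)$ only. Neither of the last two
lies in $I$: $b$ by disjointness, $\pi(b)$ because $\pi$ is unlinked. -/
theorem switch_linked {k : ℕ} {I J : Finset (Fin (2 * k))} (hIJ : Disjoint I J)
    {π : Pairing k} (hπ : π ∈ unlinked I J) {a b x : Fin (2 * k)} (hb : b ∈ J)
    (hx : x ∈ I) (hxJ : (switch π a b).1 x ∈ J) : x = a ∨ x = π.1 a := by
  rw [mem_unlinked] at hπ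
  by_contra hne
  push Not at hne
  have hxb : x ≠ b := by
    rintro rfl
    exact Finset.disjoint_left.mp hIJ hx hb
  have h1 : π.1 x ≠ π.1 a := fun h => hne.1 (π.1.injective h)
  have h2 : π.1 x ≠ b := by
    intro h
    exact hπ x hx (h ▸ hb)
  rw [switch_apply, Equiv.swap_apply_of_ne_of_ne hne.2 hxb,
    Equiv.swap_apply_of_ne_of_ne h1 h2] at hxJ
  exact hπ x hx hxJ

/-- Send $(\pi, a, b)$ to the switched pairing together with $a$ and the old partner $\pi(a)$. This
is injective: $b$ is the new partner of $a$, so the conjugating transposition is known and can be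
undone. The image has at most two links, hence at most $2$ choices of $a$ and $2k$ of $\pi(a)$ per
pairing. -/
theorem card_unlinked_mul_le {k : ℕ} {I J : Finset (Fin (2 * k))} (hIJ : Disjoint I J) :
    (unlinked I J).card * (I.card * J.card) ≤ Fintype.card (Pairing k) * (2 * (2 * k)) := by
  classical
  have hne : ∀ {a b}, a ∈ I → b ∈ J → a ≠ b := by
    rintro a _ ha hb rfl
    exact Finset.disjoint_left.mp hIJ ha hb
  set links : Pairing k → Finset (Fin (2 * k)) := fun π => I.filter fun x => π.1 x ∈ J
  set good : Finset (Pairing k) := Finset.univ.filter fun π => (links π).card ≤ 2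
  let f : Pairing k × Fin (2 * k) × Fin (2 * k) →
      (_ : Pairing k) × (_ : Fin (2 * k)) × Fin (2 * k) :=
    fun p => ⟨switch p.1 p.2.1 p.2.2, p.2.1, p.1.1 p.2.1⟩
  have h := Finset.card_le_card_of_injOn (s := unlinked I J ×ˢ I ×ˢ J)
    (t := good.sigma fun π => (links π).sigma fun _ => Finset.univ) f ?_ ?_
  · rw [Finset.card_product, Finset.card_product] at h
    refine h.trans ?_
    rw [Finset.card_sigma]
    calc ∑ π ∈ good, ((links π).sigma fun _ => (Finset.univ : Finset (Fin (2 * k)))).card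
        ≤ ∑ π ∈ good, 2 * (2 * k) := by
          apply Finset.sum_le_sum
          intro π hπ
          rw [Finset.card_sigma, Finset.sum_const, Finset.card_univ, Fintype.card_fin,
            smul_eq_mul]
          exact Nat.mul_le_mul_right _ (Finset.mem_filter.mp hπ).2
      _ ≤ _ := by
          rw [Finset.sum_const, smul_eq_mul]
          exact Nat.mul_le_mul_right _ (Finset.card_le_univ good)
  · rintro ⟨π, a, b⟩ hp
    simp only [Finset.coe_product, Set.mem_prod, Finset.mem_coe] at hp
    obtain ⟨hπ, ha, hb⟩ := hp
    simp only [f, Finset.mem_coe, Finset.mem_sigma, good, Finset.mem_filter, Finset.mem_univ,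
      true_and, and_true, links]
    refine ⟨?_, ha, ?_⟩
    · refine (Finset.card_le_card (t := {a, π.1 a}) ?_).trans Finset.card_le_two
      intro x hx
      rw [Finset.mem_filter] at hx
      rw [Finset.mem_insert, Finset.mem_singleton]
      exact switch_linked hIJ hπ hb hx.1 hx.2
    · rw [switch_apply_left π (hne ha hb)]
      exact hb
  · rintro ⟨π, a, b⟩ hp ⟨π', a', b'⟩ hp' heq
    simp only [Finset.coe_product, Set.mem_prod, Finset.mem_coe] at hp hp'
    simp only [f, Sigma.mk.injEq, heq_eq_eq] at heq
    obtain ⟨h1, rfl, h3⟩ := heq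
    have hb : b = b' := by
      rw [← switch_apply_left π (hne hp.2.1 hp.2.2), ← switch_apply_left π' (hne hp'.2.1 hp'.2.2),
        h1]
    subst hb
    have h4 : π = π' := by
      apply Subtype.ext
      have := congrArg Subtype.val h1
      simp only [switch, ← h3] at this
      exact mul_left_cancel (mul_right_cancel this)
    rw [h4]

/-- Union bound over the $3c$ block pairs that must be linked, each failing for at most $4k/m^2$ of
all pairings. -/
theorem card_not_hasObstructions_le {k c m : ℕ} (hm : 6 * c * m ≤ 2 * k) :
    Nat.card {π : Pairing k // ¬ HasObstructions π c} * (m * m)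
      ≤ 12 * c * k * Fintype.card (Pairing k) := by
  classical
  set S : Finset (Pairing k) := (Finset.range c).biUnion fun s =>
    unlinked (block k m (6 * s + 1)) (block k m (6 * s + 4)) ∪
      (unlinked (block k m (6 * s)) (block k m (6 * s + 2)) ∪
        unlinked (block k m (6 * s + 3)) (block k m (6 * s + 5))) with hS
  have hsub : Nat.card {π : Pairing k // ¬ HasObstructions π c} ≤ S.card := by
    rw [Nat.card_eq_fintype_card, Fintype.card_subtype]
    apply Finset.card_le_card
    intro π hπ
    rw [Finset.mem_filter] at hπ
    by_contra hno
    apply hπ.2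
    simp only [hS, Finset.mem_biUnion, Finset.mem_range, Finset.mem_union, mem_unlinked, not_exists,
      not_and, not_or] at hno
    push Not at hno
    exact hasObstructions_of_chords π c m hm (fun s hs => (hno s hs).1)
      (fun s hs => (hno s hs).2.1) (fun s hs => (hno s hs).2.2)
  have one : ∀ i j, i < j → j < 6 * c →
      (unlinked (block k m i) (block k m j)).card * (m * m)
        ≤ Fintype.card (Pairing k) * (2 * (2 * k)) := by
    intro i j hij hj
    have h := card_unlinked_mul_le (disjoint_block (k := k) (m := m) hij)
    have h1 : (i + 1) * m ≤ 6 * c * m := Nat.mul_le_mul_right m (by omega)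
    have h2 : (j + 1) * m ≤ 6 * c * m := Nat.mul_le_mul_right m (by omega)
    rwa [card_block (h1.trans hm), card_block (h2.trans hm)] at h
  calc Nat.card {π : Pairing k // ¬ HasObstructions π c} * (m * m)
      ≤ S.card * (m * m) := Nat.mul_le_mul_right _ hsub
    _ ≤ (∑ s ∈ Finset.range c,
          ((unlinked (block k m (6 * s + 1)) (block k m (6 * s + 4))).card +
            ((unlinked (block k m (6 * s)) (block k m (6 * s + 2))).card +
              (unlinked (block k m (6 * s + 3)) (block k m (6 * s + 5))).card))) * (m * m) := by
        refine Nat.mul_le_mul_right _ (Finset.card_biUnion_le.trans (Finset.sum_le_sum ?_))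
        intro s _
        exact (Finset.card_union_le _ _).trans
          (Nat.add_le_add_left (Finset.card_union_le _ _) _)
    _ ≤ ∑ s ∈ Finset.range c, 3 * (Fintype.card (Pairing k) * (2 * (2 * k))) := by
        rw [Finset.sum_mul]
        apply Finset.sum_le_sum
        intro s hs
        rw [Finset.mem_range] at hs
        have h1 := one (6 * s + 1) (6 * s + 4) (by omega) (by omega)
        have h2 := one (6 * s) (6 * s + 2) (by omega) (by omega)
        have h3 := one (6 * s + 3) (6 * s + 5) (by omega) (by omega)
        rw [add_mul, add_mul]
        omega
    _ = _ := by
        rw [Finset.sum_const, Finset.card_range, smul_eq_mul]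
        ring

theorem tendsto_proportion_hasObstructions (c : ℕ) :
    Tendsto (fun k : ℕ => (Nat.card {π : Pairing k // HasObstructions π c} : ℝ)
      / ((2 * k - 1)‼ : ℝ)) atTop (𝓝 1) := by
  classical
  have hlow : Tendsto (fun k : ℕ => 1 - (12 * c * (6 * (c + 1)) ^ 2 : ℝ) / k) atTop (𝓝 1) := by
    simpa using (tendsto_const_div_atTop_nhds_zero_nat (12 * c * (6 * (c + 1)) ^ 2 : ℝ)).const_sub 1
  refine tendsto_of_tendsto_of_tendsto_of_le_of_le' hlow tendsto_const_nhds ?_ ?_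
  · filter_upwards [eventually_ge_atTop (6 * (c + 1))] with k hk
    have hpos : (0 : ℝ) < ((2 * k - 1)‼ : ℕ) := by exact_mod_cast Nat.doubleFactorial_pos _
    have hk0 : (0 : ℝ) < k := by exact_mod_cast (show 0 < k by omega)
    -- Using $c+1$ keeps the divisor positive when $c = 0$. For $k \ge 6(c+1)$ the floor still
    -- leaves $m \ge k/(6(c+1))$, so $12ck/m^2$ is at most the constant over $k$ in `hlow`.
    set m := 2 * k / (6 * (c + 1)) with hm
    have hm1 : m * (6 * (c + 1)) ≤ 2 * k := Nat.div_mul_le_self _ _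
    have hm2 : k ≤ 6 * (c + 1) * m := by
      have h1 : 2 * k < (m + 1) * (6 * (c + 1)) := by
        rw [← Nat.div_lt_iff_lt_mul (by omega)]
        omega
      have h2 : (m + 1) * (6 * (c + 1)) = 6 * (c + 1) * m + 6 * (c + 1) := by ring
      omega
    have hle := card_not_hasObstructions_le (k := k) (c := c) (m := m) (by nlinarith)
    have hcompl : Nat.card {π : Pairing k // HasObstructions π c}
        + Nat.card {π : Pairing k // ¬ HasObstructions π c} = (2 * k - 1)‼ := by
      rw [← card_pairing, Nat.card_eq_fintype_card, Nat.card_eq_fintype_card]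
      have := Fintype.card_subtype_compl (fun π : Pairing k => HasObstructions π c)
      have h2 := Fintype.card_subtype_le (fun π : Pairing k => HasObstructions π c)
      omega
    rw [card_pairing] at hle
    set B := Nat.card {π : Pairing k // ¬ HasObstructions π c}
    have hB : (B : ℝ) * k ≤ 12 * c * (6 * (c + 1)) ^ 2 * ((2 * k - 1)‼ : ℕ) := by
      have h1 : (B : ℝ) * (m * m) ≤ 12 * c * k * ((2 * k - 1)‼ : ℕ) := by exact_mod_cast hle
      have h2 : (k : ℝ) ≤ 6 * (c + 1) * m := by exact_mod_cast hm2
      have h3 : (k : ℝ) * k ≤ (6 * (c + 1)) ^ 2 * (m * m) := by nlinarith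
      have h4 : (B : ℝ) * k * k ≤ 12 * c * (6 * (c + 1)) ^ 2 * ((2 * k - 1)‼ : ℕ) * k := by
        calc (B : ℝ) * k * k = B * (k * k) := by ring
          _ ≤ B * ((6 * (c + 1)) ^ 2 * (m * m)) := by gcongr
          _ = (6 * (c + 1)) ^ 2 * (B * (m * m)) := by ring
          _ ≤ (6 * (c + 1)) ^ 2 * (12 * c * k * ((2 * k - 1)‼ : ℕ)) := by gcongr
          _ = _ := by ring
      exact le_of_mul_le_mul_right h4 hk0
    have hsum : (Nat.card {π : Pairing k // HasObstructions π c} : ℝ)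
        = ((2 * k - 1)‼ : ℕ) - B := by
      rw [← hcompl]; push_cast; ring
    rw [hsum, sub_div, div_self hpos.ne']
    apply sub_le_sub_left
    rw [div_le_div_iff₀ hpos hk0]
    exact hB
  · filter_upwards with k
    apply div_le_one_of_le₀ _ (by positivity)
    rw [← card_pairing, Nat.card_eq_fintype_card]
    exact_mod_cast Fintype.card_subtype_le _

/-! ### Parametrization of solutions and existence of the limits -/

/-- The pairs of `π`, each represented by its smaller element. -/
abbrev Chord {k : ℕ} (π : Pairing k) : Type := {a : Fin (2 * k) // a < π.1 a}

theorem card_chord {k : ℕ} (π : Pairing k) : Fintype.card (Chord π) = k := by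
  have h1 : Fintype.card (Chord π) = Fintype.card {a : Fin (2 * k) // ¬ a < π.1 a} := by
    apply Fintype.card_congr
    refine ⟨fun a => ⟨π.1 a.1, ?_⟩, fun a => ⟨π.1 a.1, ?_⟩, fun a => ?_, fun a => ?_⟩
    · rw [π.apply_apply]; exact a.2.asymm
    · rw [π.apply_apply]; exact lt_of_le_of_ne (not_lt.mp a.2) (π.apply_ne _)
    · exact Subtype.ext (π.apply_apply _)
    · exact Subtype.ext (π.apply_apply _)
  have h2 := Fintype.card_subtype_compl (fun a : Fin (2 * k) => a < π.1 a)
  have h3 := Fintype.card_subtype_le (fun a : Fin (2 * k) => a < π.1 a)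
  rw [Fintype.card_fin] at h2 h3
  change Fintype.card {a : Fin (2 * k) // a < π.1 a} = _ at h1
  change Fintype.card {a : Fin (2 * k) // a < π.1 a} = k
  omega

section Parametrization

variable {R : Type*} [AddCommGroup R] {k : ℕ} (π : Pairing k)

/-- The cyclic differences `x_a - x_{a+1}` prescribed by one value per chord. -/
def chordDiff (y : Option (Chord π) → R) (a : Fin (2 * k)) : R :=
  if h : a < π.1 a then y (some ⟨a, h⟩)
  else -y (some ⟨π.1 a, by
    rw [π.apply_apply]; exact lt_of_le_of_ne (not_lt.mp h) (π.apply_ne _)⟩)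

theorem chordDiff_of_lt (y : Option (Chord π) → R) {a : Fin (2 * k)} (h : a < π.1 a) :
    chordDiff π y a = y (some ⟨a, h⟩) := dif_pos h

theorem chordDiff_apply (y : Option (Chord π) → R) (a : Fin (2 * k)) :
    chordDiff π y (π.1 a) = -chordDiff π y a := by
  unfold chordDiff
  by_cases h : a < π.1 a
  · rw [dif_pos h, dif_neg (by rw [π.apply_apply]; exact h.asymm)]
    simp only [π.apply_apply]
  · have h' : π.1 a < a := lt_of_le_of_ne (not_lt.mp h) (π.apply_ne _)
    rw [dif_neg h, dif_pos (by rw [π.apply_apply]; exact h'), neg_neg]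

theorem sum_chordDiff (y : Option (Chord π) → R) : ∑ a, chordDiff π y a = 0 := by
  classical
  have hsplit := Finset.sum_filter_add_sum_filter_not Finset.univ
    (fun a : Fin (2 * k) => a < π.1 a) (chordDiff π y)
  rw [← hsplit, add_eq_zero_iff_eq_neg, ← Finset.sum_neg_distrib]
  refine Finset.sum_bij' (fun a _ => π.1 a) (fun a _ => π.1 a) ?_ ?_ ?_ ?_ ?_
  · intro a ha
    simp only [Finset.mem_filter, Finset.mem_univ, true_and] at ha ⊢
    rw [π.apply_apply]; exact ha.asymm
  · intro a ha
    simp only [Finset.mem_filter, Finset.mem_univ, true_and] at ha ⊢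
    rw [π.apply_apply]; exact lt_of_le_of_ne (not_lt.mp ha) (π.apply_ne _)
  · intro a _; exact π.apply_apply a
  · intro a _; exact π.apply_apply a
  · intro a _; rw [chordDiff_apply, neg_neg]

/-- The solution with initial value `y none` and the chord differences `y (some _)`. -/
def tuple (y : Option (Chord π) → R) (a : Fin (2 * k)) : R :=
  y none - ∑ b ∈ Finset.univ.filter (· < a), chordDiff π y b

/-- Telescoping, except at the last position. There the step back to position $0$ is consistent
because the chord differences cancel in pairs and sum to zero. -/
theorem tuple_sub_next (y : Option (Chord π) → R) (a : Fin (2 * k)) :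
    tuple π y a - tuple π y (next a) = chordDiff π y a := by
  classical
  unfold tuple
  have ha := a.2
  have hins : insert a (Finset.univ.filter (· < a)) = Finset.univ.filter (· ≤ a) := by
    ext b; simp [le_iff_eq_or_lt]
  have hsum : chordDiff π y a + ∑ b ∈ Finset.univ.filter (· < a), chordDiff π y b
      = ∑ b ∈ Finset.univ.filter (· ≤ a), chordDiff π y b := by
    rw [← hins, Finset.sum_insert (by simp)]
  have hnext := val_next a
  split_ifs at hnext with h
  · have e1 : Finset.univ.filter (· < next a) = (∅ : Finset (Fin (2 * k))) := by
      ext b; simp only [Finset.mem_filter, Fin.lt_def, hnext]; simp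
    have e2 : Finset.univ.filter (· ≤ a) = (Finset.univ : Finset (Fin (2 * k))) := by
      ext b
      simp only [Finset.mem_filter, Finset.mem_univ, true_and, iff_true, Fin.le_def]
      omega
    rw [e2, sum_chordDiff] at hsum
    rw [e1, Finset.sum_empty, eq_neg_of_add_eq_zero_left hsum]
    abel
  · have e1 : Finset.univ.filter (· < next a) = Finset.univ.filter (· ≤ a) := by
      ext b
      simp only [Finset.mem_filter, Finset.mem_univ, true_and, Fin.lt_def, Fin.le_def]
      omega
    rw [e1, ← hsum]
    abel

theorem tuple_matched (y : Option (Chord π) → R) (a : Fin (2 * k)) :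
    tuple π y a - tuple π y (next a) = -(tuple π y (π.1 a) - tuple π y (next (π.1 a))) := by
  rw [tuple_sub_next, tuple_sub_next, chordDiff_apply, neg_neg]

/-- The initial value and the chord differences of a tuple. -/
def params (hk : 0 < k) (x : Fin (2 * k) → R) : Option (Chord π) → R
  | none => x ⟨0, by omega⟩
  | some a => x a.1 - x (next a.1)

theorem params_tuple (hk : 0 < k) (y : Option (Chord π) → R) :
    params π hk (tuple π y) = y := by
  funext j
  cases j with
  | none =>
    have : Finset.univ.filter (· < (⟨0, by omega⟩ : Fin (2 * k))) = ∅ := by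
      ext b; simp [Fin.lt_def]
    simp only [params, tuple, this, Finset.sum_empty, sub_zero]
  | some a =>
    simp only [params, tuple_sub_next]
    exact chordDiff_of_lt π y a.2

theorem chordDiff_params (hk : 0 < k) {x : Fin (2 * k) → R}
    (hx : ∀ a, x a - x (next a) = -(x (π.1 a) - x (next (π.1 a)))) (a : Fin (2 * k)) :
    chordDiff π (params π hk x) a = x a - x (next a) := by
  unfold chordDiff
  split_ifs with h
  · rfl
  · simp only [params]
    rw [hx a]

theorem tuple_params (hk : 0 < k) {x : Fin (2 * k) → R}
    (hx : ∀ a, x a - x (next a) = -(x (π.1 a) - x (next (π.1 a)))) :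
    tuple π (params π hk x) = x := by
  have h0 := congrFun (params_tuple π hk (params π hk x)) none
  simp only [params] at h0
  have : ∀ (n : ℕ) (hn : n < 2 * k), tuple π (params π hk x) ⟨n, hn⟩ = x ⟨n, hn⟩ := by
    intro n
    induction n with
    | zero => intro hn; exact h0
    | succ n ih =>
      intro hn
      have e : next (⟨n, by omega⟩ : Fin (2 * k)) = ⟨n + 1, hn⟩ :=
        Fin.ext (next_val_of_lt _ hn)
      have h1 := tuple_sub_next π (params π hk x) ⟨n, by omega⟩
      rw [chordDiff_params π hk hx, e, ih] at h1
      exact sub_right_injective h1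
  funext a
  exact this a.1 a.2

theorem tuple_map {R' : Type*} [AddCommGroup R'] (f : R →+ R') (y : Option (Chord π) → R)
    (a : Fin (2 * k)) : tuple π (fun j => f (y j)) a = f (tuple π y a) := by
  unfold tuple
  rw [map_sub, map_sum]
  congr 1
  apply Finset.sum_congr rfl
  intro b _
  unfold chordDiff
  split_ifs
  · rfl
  · rw [map_neg]

end Parametrization

/-- `tuple` as a linear map. -/
def tupleLin {k : ℕ} (π : Pairing k) : (Option (Chord π) → ℝ) →ₗ[ℝ] (Fin (2 * k) → ℝ) where
  toFun := tuple π
  map_add' y z := by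
    funext a
    simp only [tuple, Pi.add_apply]
    have : ∀ b, chordDiff π (y + z) b = chordDiff π y b + chordDiff π z b := by
      intro b; unfold chordDiff
      split_ifs
      · rfl
      · simp only [Pi.add_apply]; ring
    simp only [this, Finset.sum_add_distrib]
    ring
  map_smul' r y := by
    funext a
    exact tuple_map π (DistribSMul.toAddMonoidHom ℝ r) y a

theorem finrank_solutionSpace_le {k : ℕ} (π : Pairing k) :
    Module.finrank ℝ (solutionSpace π) ≤ k + 1 := by
  rcases Nat.eq_zero_or_pos k with rfl | hk
  · refine (Submodule.finrank_le _).trans ?_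
    simp
  · have hsub : solutionSpace π ≤ LinearMap.range (tupleLin π) := by
      intro x hx
      exact ⟨params π hk x, tuple_params π hk hx⟩
    refine (Submodule.finrank_mono hsub).trans ((LinearMap.finrank_range_le _).trans ?_)
    rw [Module.finrank_fintype_fun_eq_card, Fintype.card_option, card_chord]

/-- Parameters for which all coordinates of the solution lie in `[0, 1)`. -/
def unitRegion {k : ℕ} (π : Pairing k) : Set (Option (Chord π) → ℝ) :=
  tupleLin π ⁻¹' Set.univ.pi fun _ => Set.Ico 0 1

theorem mem_unitRegion {k : ℕ} {π : Pairing k} {y : Option (Chord π) → ℝ} :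
    y ∈ unitRegion π ↔ ∀ a, 0 ≤ tuple π y a ∧ tuple π y a < 1 := by
  simp [unitRegion, tupleLin]

theorem convex_unitRegion {k : ℕ} (π : Pairing k) : Convex ℝ (unitRegion π) :=
  (convex_pi fun _ _ => convex_Ico 0 1).linear_preimage _

theorem measurableSet_unitRegion {k : ℕ} (π : Pairing k) : MeasurableSet (unitRegion π) :=
  (LinearMap.continuous_of_finiteDimensional (tupleLin π)).measurable
    (MeasurableSet.univ_pi fun _ => measurableSet_Ico)

theorem isBounded_unitRegion {k : ℕ} (hk : 0 < k) (π : Pairing k) :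
    Bornology.IsBounded (unitRegion π) := by
  refine (Metric.isBounded_Icc (-1 : Option (Chord π) → ℝ) 1).subset ?_
  intro y hy
  rw [mem_unitRegion] at hy
  rw [← params_tuple π hk y, Set.mem_Icc, Pi.le_def, Pi.le_def]
  constructor <;> intro j <;> cases j with
  | none => simp only [params, Pi.neg_apply, Pi.one_apply]; linarith [hy ⟨0, by omega⟩]
  | some a =>
    simp only [params, Pi.neg_apply, Pi.one_apply]
    linarith [hy a.1, hy (next a.1)]

open scoped Pointwise in
-- Integer parameters correspond to integer solutions, and dividing by $N$ sends the range
-- $0,\dots,N-1$ into $[0,1)$. The half-open interval makes the count exact.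
theorem card_unitRegion_inter_lattice {k : ℕ} (hk : 0 < k) (π : Pairing k) {N : ℕ} (hN : 0 < N) :
    Nat.card ↑(unitRegion π ∩ (N : ℝ)⁻¹ •
      (Submodule.span ℤ (Set.range (Pi.basisFun ℝ (Option (Chord π)))) :
        Set (Option (Chord π) → ℝ))) = (matchedTuples π N).card := by
  have hN' : (0 : ℝ) < N := by exact_mod_cast hN
  symm
  rw [← Nat.card_eq_finsetCard]
  let q : (Fin (2 * k) → Fin N) → Option (Chord π) → ℤ := fun i =>
    params π hk fun a => ((i a : ℕ) : ℤ)
  have hsol : ∀ i ∈ matchedTuples π N, tuple π (q i) = fun a => ((i a : ℕ) : ℤ) := by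
    intro i hi
    rw [matchedTuples, Finset.mem_filter] at hi
    exact tuple_params π hk hi.2
  have hscale : ∀ (y : Option (Chord π) → ℤ) (a : Fin (2 * k)),
      tuple π (fun j => (N : ℝ)⁻¹ * (y j : ℝ)) a = (N : ℝ)⁻¹ * ((tuple π y a : ℤ) : ℝ) := fun y a =>
    tuple_map π ((AddMonoidHom.mulLeft (N : ℝ)⁻¹).comp (Int.castAddHom ℝ)) y a
  have hmem : ∀ x : Option (Chord π) → ℝ, x ∈ (N : ℝ)⁻¹ •
      (Submodule.span ℤ (Set.range (Pi.basisFun ℝ (Option (Chord π)))) :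
        Set (Option (Chord π) → ℝ)) ↔
      ∃ y : Option (Chord π) → ℤ, x = fun j => (N : ℝ)⁻¹ * (y j : ℝ) := by
    intro x
    rw [Set.mem_smul_set]
    constructor
    · rintro ⟨z, hz, rfl⟩
      rw [SetLike.mem_coe, Module.Basis.mem_span_iff_repr_mem] at hz
      choose y hy using hz
      refine ⟨y, ?_⟩
      funext j
      have := hy j
      simp only [Pi.basisFun_repr, algebraMap_int_eq, eq_intCast] at this
      rw [this]; rfl
    · rintro ⟨y, rfl⟩
      refine ⟨fun j => (y j : ℝ), ?_, rfl⟩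
      rw [SetLike.mem_coe, Module.Basis.mem_span_iff_repr_mem]
      intro j
      exact ⟨y j, by simp⟩
  refine Nat.card_congr (Equiv.ofBijective
    (fun i : ↥(matchedTuples π N) => (⟨fun j => (N : ℝ)⁻¹ * (q i.1 j : ℝ), ?_, ?_⟩ :
      ↑(unitRegion π ∩ (N : ℝ)⁻¹ •
        (Submodule.span ℤ (Set.range (Pi.basisFun ℝ (Option (Chord π)))) :
        Set (Option (Chord π) → ℝ))))) ⟨?_, ?_⟩)
  · rw [mem_unitRegion]
    intro a
    rw [hscale, hsol i.1 i.2]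
    have h1 : (((i.1 a : ℕ) : ℤ) : ℝ) < N := by exact_mod_cast (i.1 a).2
    refine ⟨by positivity, ?_⟩
    rw [inv_mul_lt_iff₀ hN', mul_one]
    exact h1
  · exact (hmem _).2 ⟨_, rfl⟩
  · intro i i' h
    have h1 : q i.1 = q i'.1 := by
      funext j
      have := congrFun (congrArg Subtype.val h) j
      simp only at this
      exact_mod_cast mul_left_cancel₀ (inv_ne_zero hN'.ne') this
    have h2 := hsol i.1 i.2
    rw [h1, hsol i'.1 i'.2] at h2
    apply Subtype.ext
    funext a
    have := congrFun h2 a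
    exact Fin.ext (by exact_mod_cast this.symm)
  · rintro ⟨x, hx1, hx2⟩
    obtain ⟨y, rfl⟩ := (hmem x).1 hx2
    rw [mem_unitRegion] at hx1
    have hb : ∀ a, 0 ≤ tuple π y a ∧ tuple π y a < N := by
      intro a
      obtain ⟨h1, h2⟩ := hx1 a
      rw [hscale] at h1 h2
      rw [inv_mul_lt_iff₀ hN', mul_one] at h2
      have h1' : (0 : ℝ) ≤ ((tuple π y a : ℤ) : ℝ) := nonneg_of_mul_nonneg_right h1 (by positivity)
      exact ⟨by exact_mod_cast h1', by exact_mod_cast h2⟩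
    let i : Fin (2 * k) → Fin N := fun a => ⟨(tuple π y a).toNat, by have := hb a; omega⟩
    have hi : (fun a => ((i a : ℕ) : ℤ)) = tuple π y := by
      funext a
      exact Int.toNat_of_nonneg (hb a).1
    have hi' : ∀ a, ((i a : ℕ) : ℤ) = tuple π y a := congrFun hi
    refine ⟨⟨i, ?_⟩, ?_⟩
    · rw [matchedTuples, Finset.mem_filter]
      refine ⟨Finset.mem_univ _, fun a => ?_⟩
      simp only [hi']
      exact tuple_matched π y a
    · apply Subtype.ext
      simp only [q, hi, params_tuple]

/-- The limit is the volume of `unitRegion π`: the region is bounded, and its frontier is null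
because it is convex. -/
theorem exists_tendsto_contribution {k : ℕ} (π : Pairing k) :
    ∃ v, Tendsto (fun N : ℕ => contribution π N) atTop (𝓝 v) := by
  rcases Nat.eq_zero_or_pos k with rfl | hk
  -- For $k = 0$ only the empty tuple exists, so the contribution is at most $1/N$ and its limit is
  -- $0$, although the zeroth moment is $1$.
  · refine ⟨0, squeeze_zero (g := fun N : ℕ => (1 : ℝ) / N) (fun N => ?_) (fun N => ?_)
      (tendsto_const_div_atTop_nhds_zero_nat 1)⟩
    · unfold contribution; positivity
    · unfold contribution
      rw [zero_add, pow_one]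
      gcongr
      refine (Nat.cast_le.mpr (Finset.card_le_univ _)).trans ?_
      simp
  · refine ⟨_, (tendsto_card_div_pow_atTop_volume (unitRegion π) (isBounded_unitRegion hk π)
      (measurableSet_unitRegion π) ((convex_unitRegion π).addHaar_frontier volume)).congr' ?_⟩
    filter_upwards [eventually_gt_atTop 0] with N hN
    rw [card_unitRegion_inter_lattice hk π hN, Fintype.card_option, card_chord]
    rfl

/-! ### Each independent obstruction costs a factor 2/3 -/

/-- The triples `(x, y, z)` of indices for which `x + y - z` is again an admissible index. -/
def admissibleTriples (N : ℕ) : Finset (Fin 3 → Fin N) :=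
  Finset.univ.filter fun z =>
    (z 2 : ℕ) ≤ (z 0 : ℕ) + (z 1 : ℕ) ∧ (z 0 : ℕ) + (z 1 : ℕ) < (z 2 : ℕ) + N

theorem sum_abs_sub (N : ℕ) :
    3 * ∑ x ∈ Finset.range N, ∑ y ∈ Finset.range N, |(x : ℤ) - y| = (N : ℤ) ^ 3 - N := by
  have lin : ∀ N : ℕ, 2 * ∑ y ∈ Finset.range N, |(N : ℤ) - y| = N * (N + 1) := by
    intro N
    have h : ∑ y ∈ Finset.range N, |(N : ℤ) - y| = ∑ y ∈ Finset.range N, ((N : ℤ) - y) := by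
      apply Finset.sum_congr rfl
      intro y hy
      rw [Finset.mem_range] at hy
      exact abs_of_nonneg (by omega)
    rw [h, Finset.sum_sub_distrib, Finset.sum_const, Finset.card_range, nsmul_eq_mul, mul_sub]
    have h2 : 2 * ∑ y ∈ Finset.range N, (y : ℤ) = N * (N - 1) := by
      clear h
      induction N with
      | zero => simp
      | succ n ih => rw [Finset.sum_range_succ, mul_add, ih]; push_cast; ring
    rw [h2]
    ring
  induction N with
  | zero => simp
  | succ n ih =>
    rw [Finset.sum_range_succ]
    simp only [Finset.sum_range_succ, Finset.sum_add_distrib]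
    have h1 : ∑ x ∈ Finset.range n, |(x : ℤ) - n| = ∑ y ∈ Finset.range n, |(n : ℤ) - y| :=
      Finset.sum_congr rfl fun x _ => abs_sub_comm _ _
    rw [h1, sub_self, abs_zero]
    have h2 := lin n
    push_cast
    linarith

/-- After reversing $y$, the admissible $z$ fill the intersection of $[0,N)$ with its translate by
$x-y$, of size $N-|x-y|$. Summing gives $N^3-(N^3-N)/3$. -/
theorem card_admissibleTriples (N : ℕ) :
    3 * ((admissibleTriples N).card : ℤ) = 2 * (N : ℤ) ^ 3 + N := by
  have inner : ∀ x y : Fin N, ((Finset.univ.filter fun z : Fin N =>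
      (z : ℕ) ≤ (x : ℕ) + (y.rev : ℕ) ∧ (x : ℕ) + (y.rev : ℕ) < (z : ℕ) + N).card : ℤ)
      = N - |((x : ℕ) : ℤ) - (y : ℕ)| := by
    intro x y
    have hx := x.2
    have hy := y.2
    have himg : (Finset.univ.filter fun z : Fin N =>
        (z : ℕ) ≤ (x : ℕ) + (y.rev : ℕ) ∧ (x : ℕ) + (y.rev : ℕ) < (z : ℕ) + N).map Fin.valEmbedding
        = Finset.Ico ((x : ℕ) - y) (min N (N + x - y)) := by
      ext z
      simp only [Finset.mem_map, Finset.mem_filter, Finset.mem_univ, true_and,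
        Fin.valEmbedding_apply, Finset.mem_Ico, Fin.val_rev]
      constructor
      · rintro ⟨w, hw, rfl⟩
        have := w.2
        omega
      · intro hz
        refine ⟨⟨z, by omega⟩, ?_, rfl⟩
        simp only
        omega
    rw [← Finset.card_map Fin.valEmbedding, himg, Nat.card_Ico]
    rcases le_total (x : ℕ) (y : ℕ) with h | h
    · rw [abs_of_nonpos (by omega)]; omega
    · rw [abs_of_nonneg (by omega)]; omega
  have hcard : ((admissibleTriples N).card : ℤ) = ∑ x : Fin N, ∑ y : Fin N,
      ((Finset.univ.filter fun z : Fin N =>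
      (z : ℕ) ≤ (x : ℕ) + (y.rev : ℕ) ∧ (x : ℕ) + (y.rev : ℕ) < (z : ℕ) + N).card : ℤ) := by
    have e : ∀ x : Fin N, ∑ y : Fin N, ((Finset.univ.filter fun z : Fin N =>
        (z : ℕ) ≤ (x : ℕ) + (y.rev : ℕ) ∧ (x : ℕ) + (y.rev : ℕ) < (z : ℕ) + N).card : ℤ)
        = ∑ y : Fin N, ((Finset.univ.filter fun z : Fin N =>
        (z : ℕ) ≤ (x : ℕ) + (y : ℕ) ∧ (x : ℕ) + (y : ℕ) < (z : ℕ) + N).card : ℤ) := fun x =>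
      Equiv.sum_comp Fin.revPerm (fun y : Fin N => ((Finset.univ.filter fun z : Fin N =>
        (z : ℕ) ≤ (x : ℕ) + (y : ℕ) ∧ (x : ℕ) + (y : ℕ) < (z : ℕ) + N).card : ℤ))
    simp only [e]
    simp only [Finset.card_filter, Nat.cast_sum]
    rw [admissibleTriples, Finset.card_filter, Nat.cast_sum]
    rw [← Fintype.sum_prod_type', ← Fintype.sum_prod_type']
    refine Fintype.sum_equiv
      ⟨fun z => ((z 0, z 1), z 2), fun p => ![p.1.1, p.1.2, p.2], fun z => ?_, fun p => rfl⟩ _ _ ?_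
    · funext j; fin_cases j <;> rfl
    · intro z; rfl
  rw [hcard]
  simp only [inner, Finset.sum_sub_distrib, Finset.sum_const, Finset.card_univ, Fintype.card_fin]
  have h := sum_abs_sub N
  simp only [← Fin.sum_univ_eq_sum_range (fun x : ℕ => ∑ y ∈ Finset.range N, |(x : ℤ) - y|)] at h
  simp only [fun x : Fin N => Finset.sum_range (n := N) (fun y : ℕ => |((x : ℕ) : ℤ) - y|)] at h
  rw [mul_sub, h, nsmul_eq_mul, nsmul_eq_mul]
  ring

theorem tendsto_card_admissibleTriples :
    Tendsto (fun N : ℕ => ((admissibleTriples N).card : ℝ) / (N : ℝ) ^ 3) atTop (𝓝 (2 / 3)) := by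
  have h : Tendsto (fun N : ℕ => (2 / 3 : ℝ) + 1 / 3 * ((1 / (N : ℝ)) * (1 / (N : ℝ)))) atTop
      (𝓝 (2 / 3 + 1 / 3 * (0 * 0))) :=
    ((tendsto_one_div_atTop_nhds_zero_nat.mul tendsto_one_div_atTop_nhds_zero_nat).const_mul
      _).const_add _
  rw [mul_zero, mul_zero, add_zero] at h
  refine h.congr' ?_
  filter_upwards [eventually_gt_atTop 0] with N hN
  have hN' : (0 : ℝ) < N := by exact_mod_cast hN
  have hc : 3 * ((admissibleTriples N).card : ℝ) = 2 * (N : ℝ) ^ 3 + N := by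
    exact_mod_cast card_admissibleTriples N
  have hc' : ((admissibleTriples N).card : ℝ) = (2 * (N : ℝ) ^ 3 + N) / 3 := by linarith
  rw [hc']
  field_simp

/-- The difference of the two tuples is a real solution. The functionals vanishing on it form a
subspace containing the indices in $b$, hence all indices. -/
theorem matchedTuples_eq_of_spanning {k N : ℕ} {π : Pairing k} {b : Set (Fin (2 * k))}
    (hb : index π '' Set.univ ⊆ Submodule.span ℝ (index π '' b))
    {i i' : Fin (2 * k) → Fin N} (hi : i ∈ matchedTuples π N) (hi' : i' ∈ matchedTuples π N)
    (h : ∀ a ∈ b, i a = i' a) : i = i' := by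
  have mem : ∀ j ∈ matchedTuples π N, (fun a => ((j a : ℕ) : ℝ)) ∈ solutionSpace π := by
    intro j hj a
    rw [matchedTuples, Finset.mem_filter] at hj
    have := hj.2 a
    simp only
    exact_mod_cast this
  let d : solutionSpace π := ⟨_, mem i hi⟩ - ⟨_, mem i' hi'⟩
  have hd : ∀ a, index π a d = ((i a : ℕ) : ℝ) - ((i' a : ℕ) : ℝ) := fun a => rfl
  have hspan : Submodule.span ℝ (index π '' b) ≤
      LinearMap.ker (Module.Dual.eval ℝ (solutionSpace π) d) := by
    rw [Submodule.span_le]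
    rintro _ ⟨a, ha, rfl⟩
    rw [SetLike.mem_coe, LinearMap.mem_ker, Module.Dual.eval_apply, hd, h a ha, sub_self]
  funext a
  have := hspan (hb ⟨a, Set.mem_univ a, rfl⟩)
  rw [LinearMap.mem_ker, Module.Dual.eval_apply, hd, sub_eq_zero] at this
  exact Fin.ext (by exact_mod_cast this)

/-- Extend the $3c$ independent indices to a basis chosen among the index functionals, of size at
most $k+1$. A tuple is determined by its basis values. Each of the $c$ triples is admissible because
$i_{a_s}$ is in range; the at most $k+1-3c$ remaining values are bounded trivially. The factor
$N^{3c}$ avoids subtraction in the exponent. -/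
theorem card_matchedTuples_le {k c : ℕ} {π : Pairing k} (h : HasObstructions π c) {N : ℕ}
    (hN : 0 < N) :
    (matchedTuples π N).card * N ^ (3 * c) ≤ (admissibleTriples N).card ^ c * N ^ (k + 1) := by
  classical
  obtain ⟨a, ha⟩ := h
  let pos : Fin c × Fin 3 → Fin (2 * k) := fun t =>
    ![next (a t.1), next (π.1 (a t.1)), π.1 (a t.1)] t.2
  have hpos : (fun t : Fin c × Fin 3 =>
      (![index π (next (a t.1)), index π (next (π.1 (a t.1))), index π (π.1 (a t.1))] :
        Fin 3 → (solutionSpace π →ₗ[ℝ] ℝ)) t.2) = index π ∘ pos := by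
    funext ⟨s, j⟩
    fin_cases j <;> rfl
  rw [hpos] at ha
  have hinj : Function.Injective pos := ha.injective.of_comp
  have hon : LinearIndepOn ℝ (index π) (Set.range pos) :=
    (linearIndepOn_range_iff hinj (index π)).2 ha
  obtain ⟨b, -, hsub, hspan, hb⟩ := exists_linearIndepOn_extension hon (Set.subset_univ _)
  have hcard : Fintype.card b ≤ k + 1 := by
    have h1 := LinearIndependent.fintype_card_le_finrank hb
    have h2 : Module.finrank ℝ (solutionSpace π →ₗ[ℝ] ℝ) = Module.finrank ℝ (solutionSpace π) :=
      Subspace.dual_finrank_eq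
    rw [h2] at h1
    exact h1.trans (finrank_solutionSpace_le π)
  let R := {x : Fin (2 * k) // x ∈ b ∧ x ∉ Set.range pos}
  have hR : Fintype.card R + 3 * c ≤ k + 1 := by
    refine le_trans ?_ hcard
    have h1 : Fintype.card (R ⊕ (Fin c × Fin 3)) ≤ Fintype.card b := by
      refine Fintype.card_le_of_injective
        (Sum.elim (fun r => ⟨r.1, r.2.1⟩) fun t => ⟨pos t, hsub ⟨t, rfl⟩⟩) ?_
      rintro (r | t) (r' | t') hrt
      · simp only [Sum.elim_inl, Subtype.mk.injEq] at hrt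
        exact congrArg Sum.inl (Subtype.ext hrt)
      · simp only [Sum.elim_inl, Sum.elim_inr, Subtype.mk.injEq] at hrt
        exact absurd ⟨t', hrt.symm⟩ r.2.2
      · simp only [Sum.elim_inl, Sum.elim_inr, Subtype.mk.injEq] at hrt
        exact absurd ⟨t, hrt⟩ r'.2.2
      · simp only [Sum.elim_inr, Subtype.mk.injEq] at hrt
        exact congrArg Sum.inr (hinj hrt)
    rw [Fintype.card_sum, Fintype.card_prod, Fintype.card_fin, Fintype.card_fin] at h1
    omega
  have hT : ∀ i ∈ matchedTuples π N, ∀ s, (fun j => i (pos (s, j))) ∈ admissibleTriples N := by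
    intro i hi s
    rw [matchedTuples, Finset.mem_filter] at hi
    have h1 := hi.2 (a s)
    have h2 := (i (a s)).2
    rw [admissibleTriples, Finset.mem_filter]
    refine ⟨Finset.mem_univ _, ?_⟩
    simp only [pos, Matrix.cons_val]
    omega
  have hle : Fintype.card (matchedTuples π N) ≤
      Fintype.card ((Fin c → admissibleTriples N) × (R → Fin N)) := by
    refine Fintype.card_le_of_injective
      (fun i => (fun s => ⟨_, hT i.1 i.2 s⟩, fun r => i.1 r.1)) ?_
    intro i i' hii
    rw [Prod.mk.injEq] at hii
    apply Subtype.ext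
    refine matchedTuples_eq_of_spanning hspan i.2 i'.2 fun x hx => ?_
    by_cases hxp : x ∈ Set.range pos
    · obtain ⟨⟨s, j⟩, rfl⟩ := hxp
      exact congrFun (congrArg Subtype.val (congrFun hii.1 s)) j
    · exact congrFun hii.2 ⟨x, hx, hxp⟩
  rw [Fintype.card_coe, Fintype.card_prod, Fintype.card_fun, Fintype.card_fun, Fintype.card_coe,
    Fintype.card_fin, Fintype.card_fin] at hle
  calc (matchedTuples π N).card * N ^ (3 * c)
      ≤ (admissibleTriples N).card ^ c * N ^ Fintype.card R * N ^ (3 * c) :=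
        Nat.mul_le_mul_right _ hle
    _ = (admissibleTriples N).card ^ c * N ^ (Fintype.card R + 3 * c) := by
        rw [pow_add, mul_assoc]
    _ ≤ _ := Nat.mul_le_mul_left _ (Nat.pow_le_pow_right hN hR)

theorem limit_contribution_le {k c : ℕ} {π : Pairing k} (h : HasObstructions π c) {v : ℝ}
    (hv : Tendsto (fun N : ℕ => contribution π N) atTop (𝓝 v)) : v ≤ (2 / 3) ^ c := by
  refine le_of_tendsto_of_tendsto hv (tendsto_card_admissibleTriples.pow c) ?_
  filter_upwards [eventually_gt_atTop 0] with N hN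
  have hN' : (0 : ℝ) < N := by exact_mod_cast hN
  unfold contribution
  rw [div_pow, ← pow_mul, div_le_div_iff₀ (by positivity) (by positivity)]
  exact_mod_cast card_matchedTuples_le h hN

theorem hasObstructions_zero {k : ℕ} (π : Pairing k) : HasObstructions π 0 :=
  ⟨Fin.elim0, linearIndependent_empty_type⟩

/-! ### Degenerate tuples are negligible -/

/-- A sum-zero vector subject to the relations `d a = ε a * d (f a)` is determined by its
entries in `S`. -/
def IsDetermining {n : ℕ} (f : Fin n → Fin n) (ε : Fin n → SignType) (S : Finset (Fin n)) : Prop :=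
  ∀ d : Fin n → ℤ, (∀ a, d a = (ε a : ℤ) * d (f a)) → ∑ a, d a = 0 → (∀ a ∈ S, d a = 0) →
    ∀ a, d a = 0

/-- `π` matches equal absolute values of `d` with opposite signs, and there are no further
coincidences. -/
def IsExactMatching {k : ℕ} (d : Fin (2 * k) → ℤ) (π : Pairing k) : Prop :=
  (∀ a, d a = -d (π.1 a)) ∧ (∀ a, d a ≠ 0) ∧
    ∀ a b, (d b).natAbs = (d a).natAbs → b = a ∨ b = π.1 a

/-- Group positions by $|d|$ and take one representative per class. Classes have at least two
elements, so there are at most $k$. One degree of freedom is saved if there are fewer than $k$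
classes, if one class has $d = 0$, or if a class of size two has equal signs, for then the zero sum
forces its value. Otherwise the classes form an exact matching. -/
theorem exists_isDetermining {k : ℕ} (hk : 0 < k) (d : Fin (2 * k) → ℤ)
    (hrep : ∀ a, ∃ b, b ≠ a ∧ (d b).natAbs = (d a).natAbs)
    (hd : ¬ ∃ π : Pairing k, IsExactMatching d π) :
    ∃ (f : Fin (2 * k) → Fin (2 * k)) (ε : Fin (2 * k) → SignType) (S : Finset (Fin (2 * k))),
      S.card + 1 ≤ k ∧ (∀ a, d a = (ε a : ℤ) * d (f a)) ∧ IsDetermining f ε S := by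
  classical
  have : Nonempty (Fin (2 * k)) := ⟨⟨0, by omega⟩⟩
  let e : Fin (2 * k) → ℕ := fun a => (d a).natAbs
  let f : Fin (2 * k) → Fin (2 * k) := fun a => Function.invFun e (e a)
  have hef : ∀ a, e (f a) = e a := fun a => Function.invFun_eq ⟨a, rfl⟩
  have hfe : ∀ {a b}, f a = f b ↔ e a = e b := by
    intro a b
    constructor
    · intro h; rw [← hef a, h, hef b]
    · intro h; simp only [f, h]
  have hff : ∀ a, f (f a) = f a := fun a => hfe.2 (hef a)
  -- The sign is $0$ on the class $d = 0$, so the relation itself forces that class to vanish.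
  let ε : Fin (2 * k) → SignType := fun a => SignType.sign (d a) * SignType.sign (d (f a))
  have hε : ∀ a, d a = (ε a : ℤ) * d (f a) := by
    intro a
    have h1 : |d (f a)| = |d a| := by
      rw [Int.abs_eq_natAbs, Int.abs_eq_natAbs]
      exact_mod_cast hef a
    simp only [ε, SignType.coe_mul]
    rw [mul_assoc, sign_mul_self, h1, sign_mul_abs]
  let S₀ : Finset (Fin (2 * k)) := Finset.univ.image f
  have hfS : ∀ a, f a ∈ S₀ := fun a => Finset.mem_image_of_mem f (Finset.mem_univ a)
  have hfib : ∀ r ∈ S₀, 2 ≤ (Finset.univ.filter fun a => f a = r).card := by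
    intro r hr
    obtain ⟨a, -, rfl⟩ := Finset.mem_image.1 hr
    obtain ⟨b, hb, hba⟩ := hrep a
    refine Finset.one_lt_card.2 ⟨a, by simp, b, ?_, hb.symm⟩
    simp only [Finset.mem_filter, Finset.mem_univ, true_and]
    exact hfe.2 hba
  have hsum : ∑ r ∈ S₀, (Finset.univ.filter fun a => f a = r).card = 2 * k := by
    rw [← Finset.card_eq_sum_card_image f Finset.univ, Finset.card_univ, Fintype.card_fin]
  have hS₀ : S₀.card ≤ k := by
    have h1 := Finset.sum_le_sum hfib
    rw [hsum, Finset.sum_const, smul_eq_mul] at h1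
    omega
  -- it suffices that one representative is forced to vanish
  have remove : ∀ r ∈ S₀, (∀ d' : Fin (2 * k) → ℤ, (∀ a, d' a = (ε a : ℤ) * d' (f a)) →
      ∑ a, d' a = 0 → (∀ a, f a ≠ r → d' a = 0) → d' r = 0) →
      ∃ (f : Fin (2 * k) → Fin (2 * k)) (ε : Fin (2 * k) → SignType) (S : Finset (Fin (2 * k))),
      S.card + 1 ≤ k ∧ (∀ a, d a = (ε a : ℤ) * d (f a)) ∧ IsDetermining f ε S := by
    intro r hr h
    refine ⟨f, ε, S₀.erase r, ?_, hε, ?_⟩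
    · rw [Finset.card_erase_of_mem hr]
      have := Finset.card_pos.2 ⟨r, hr⟩
      omega
    · intro d' h1 h2 h3
      have h4 : ∀ a, f a ≠ r → d' a = 0 := by
        intro a ha
        rw [h1 a, h3 (f a) (Finset.mem_erase.2 ⟨ha, hfS a⟩), mul_zero]
      intro a
      by_cases ha : f a = r
      · rw [h1 a, ha, h d' h1 h2 h4, mul_zero]
      · exact h4 a ha
  by_cases hlt : S₀.card + 1 ≤ k
  · refine ⟨f, ε, S₀, hlt, hε, ?_⟩
    intro d' h1 _ h3 a
    rw [h1 a, h3 (f a) (hfS a), mul_zero]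
  by_cases hzero : ∃ a, d a = 0
  · obtain ⟨a, ha⟩ := hzero
    refine remove (f a) (hfS a) ?_
    intro d' h1 _ _
    have h2 : d (f a) = 0 := by
      have := hef a
      simp only [e, ha, Int.natAbs_zero, Int.natAbs_eq_zero] at this
      exact this
    rw [h1 (f a)]
    simp [ε, h2]
  push Not at hzero
  -- There are now exactly $k$ classes, each of size at least $2$, with total size $2k$; equality
  -- holds throughout.
  have hfib2 : ∀ r ∈ S₀, 2 = (Finset.univ.filter fun a => f a = r).card := by
    refine (Finset.sum_eq_sum_iff_of_le hfib).1 ?_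
    rw [hsum, Finset.sum_const, smul_eq_mul]
    omega
  have huniq : ∀ a b c, b ≠ a → c ≠ a → e b = e a → e c = e a → c = b := by
    intro a b c hb hc heb hec
    by_contra hcb
    have h1 := hfib2 (f a) (hfS a)
    have h2 : ({a, b, c} : Finset (Fin (2 * k))).card = 3 :=
      Finset.card_eq_three.2 ⟨a, b, c, hb.symm, hc.symm, fun h => hcb h.symm, rfl⟩
    have h3 : ({a, b, c} : Finset (Fin (2 * k))) ⊆ Finset.univ.filter fun x => f x = f a := by
      intro x hx
      simp only [Finset.mem_insert, Finset.mem_singleton] at hx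
      simp only [Finset.mem_filter, Finset.mem_univ, true_and]
      rw [hfe]
      rcases hx with rfl | rfl | rfl
      · rfl
      · exact heb
      · exact hec
    have := Finset.card_le_card h3
    omega
  choose σ hσne hσe using hrep
  have hσσ : Function.Involutive σ := by
    intro a
    exact (huniq (σ a) (σ (σ a)) a (hσne _) (hσne a).symm (hσe _) (hσe a).symm).symm
  by_cases hopp : ∀ a, d a = -d (σ a)
  · exact absurd ⟨⟨hσσ.toPerm, fun a => ⟨hσσ a, hσne a⟩⟩, hopp, hzero, fun a b hab => by
      by_cases hba : b = a
      · exact Or.inl hba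
      · exact Or.inr (huniq a (σ a) b (hσne a) hba (hσe a) hab)⟩ hd
  · push Not at hopp
    obtain ⟨a, ha⟩ := hopp
    have heq : d (σ a) = d a := by
      rcases Int.natAbs_eq_natAbs_iff.1 (hσe a) with h | h
      · exact h
      · exact absurd (by rw [h, neg_neg]) ha
    have hfσ : f (σ a) = f a := hfe.2 (hσe a)
    refine remove (f a) (hfS a) ?_
    intro d' h1 h2 h3
    have h4 : ∑ x, d' x = d' a + d' (σ a) := by
      rw [← Finset.sum_pair (hσne a).symm]
      symm
      apply Finset.sum_subset (Finset.subset_univ _)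
      intro x _ hx
      simp only [Finset.mem_insert, Finset.mem_singleton, not_or] at hx
      apply h3
      intro hfx
      exact hx.2 (huniq a (σ a) x (hσne a) hx.1 (hσe a) (hfe.1 hfx))
    have h5 : d' (σ a) = d' a := by
      rw [h1 (σ a), h1 a, hfσ]
      simp only [ε, heq, hfσ]
    have h6 : (ε a : ℤ) ≠ 0 := by
      intro h
      have := hε a
      rw [h, zero_mul] at this
      exact hzero a this
    have h7 : d' a = 0 := by omega
    rw [h1 a] at h7
    exact (mul_eq_zero.1 h7).resolve_left h6

/-- The cyclic differences `i_a - i_{a+1}`. -/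
def cyclicDiff {k N : ℕ} (i : Fin (2 * k) → Fin N) (a : Fin (2 * k)) : ℤ :=
  ((i a : ℕ) : ℤ) - ((i (next a) : ℕ) : ℤ)

theorem mem_matchedTuples {k N : ℕ} {π : Pairing k} {i : Fin (2 * k) → Fin N} :
    i ∈ matchedTuples π N ↔ ∀ a, cyclicDiff i a = -cyclicDiff i (π.1 a) := by
  simp [matchedTuples, cyclicDiff]

theorem sum_cyclicDiff {k N : ℕ} (i : Fin (2 * k) → Fin N) : ∑ a, cyclicDiff i a = 0 := by
  simp only [cyclicDiff, Finset.sum_sub_distrib]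
  rw [sub_eq_zero]
  exact (Equiv.sum_comp (finRotate (2 * k)) (fun a => ((i a : ℕ) : ℤ))).symm

theorem eq_of_cyclicDiff_eq {k N : ℕ} (hk : 0 < k) {i i' : Fin (2 * k) → Fin N}
    (h0 : i ⟨0, by omega⟩ = i' ⟨0, by omega⟩) (h : ∀ a, cyclicDiff i a = cyclicDiff i' a) :
    i = i' := by
  have : ∀ (n : ℕ) (hn : n < 2 * k), i ⟨n, hn⟩ = i' ⟨n, hn⟩ := by
    intro n
    induction n with
    | zero => intro hn; exact h0
    | succ n ih =>
      intro hn
      have e : next (⟨n, by omega⟩ : Fin (2 * k)) = ⟨n + 1, hn⟩ :=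
        Fin.ext (next_val_of_lt _ hn)
      have h1 := h ⟨n, by omega⟩
      simp only [cyclicDiff, e, ih (by omega)] at h1
      exact Fin.ext (by omega)
  funext a
  exact this a.1 a.2

/-- The tuples all of whose absolute differences are repeated, but which do not come from exactly
one pairing of opposite differences. -/
def degenerateTuples (k N : ℕ) : Finset (Fin (2 * k) → Fin N) :=
  open Classical in
  Finset.univ.filter fun i =>
    (∀ a, ∃ b, b ≠ a ∧ (cyclicDiff i b).natAbs = (cyclicDiff i a).natAbs) ∧
      ¬ ∃ π : Pairing k, IsExactMatching (cyclicDiff i) π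

/-- A tuple is fixed by its first entry and its differences on $S$, since the difference vectors of
two such tuples subtract to a vector obeying the same relations. The case $N = 0$ is separate
because $2N+1 \le 3N$ fails there. -/
theorem card_le_of_isDetermining {k : ℕ} (hk : 0 < k) {f : Fin (2 * k) → Fin (2 * k)}
    {ε : Fin (2 * k) → SignType} {S : Finset (Fin (2 * k))} (hS : S.card + 1 ≤ k)
    (hdet : IsDetermining f ε S) {N : ℕ} (T : Finset (Fin (2 * k) → Fin N))
    (hT : ∀ i ∈ T, ∀ a, cyclicDiff i a = (ε a : ℤ) * cyclicDiff i (f a)) :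
    T.card ≤ 3 ^ k * N ^ k := by
  classical
  rcases Nat.eq_zero_or_pos N with rfl | hN
  · have : IsEmpty (Fin (2 * k) → Fin 0) := ⟨fun i => (i ⟨0, by omega⟩).elim0⟩
    rw [Finset.eq_empty_of_isEmpty T]
    simp
  have hrange : ∀ (i : Fin (2 * k) → Fin N) (a), cyclicDiff i a ∈ Finset.Icc (-(N : ℤ)) N := by
    intro i a
    rw [Finset.mem_Icc, cyclicDiff]
    have h1 := (i a).2
    have h2 := (i (next a)).2
    omega
  have hle : Fintype.card T ≤ Fintype.card (Fin N × (S → Finset.Icc (-(N : ℤ)) N)) := by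
    refine Fintype.card_le_of_injective
      (fun i => (i.1 ⟨0, by omega⟩, fun a => ⟨cyclicDiff i.1 a.1, hrange i.1 a.1⟩)) ?_
    intro i i' hii
    rw [Prod.mk.injEq] at hii
    apply Subtype.ext
    refine eq_of_cyclicDiff_eq hk hii.1 fun a => ?_
    rw [← sub_eq_zero]
    refine hdet (fun a => cyclicDiff i.1 a - cyclicDiff i'.1 a) ?_ ?_ ?_ a
    · intro a
      rw [hT i.1 i.2 a, hT i'.1 i'.2 a, mul_sub]
    · rw [Finset.sum_sub_distrib, sum_cyclicDiff, sum_cyclicDiff, sub_zero]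
    · intro a ha
      have := congrArg Subtype.val (congrFun hii.2 ⟨a, ha⟩)
      simp only at this
      rw [this, sub_self]
  rw [Fintype.card_coe, Fintype.card_prod, Fintype.card_fun, Fintype.card_coe, Fintype.card_coe,
    Fintype.card_fin, Int.card_Icc] at hle
  have e1 : ((N : ℤ) + 1 - -(N : ℤ)).toNat = 2 * N + 1 := by omega
  rw [e1] at hle
  calc T.card ≤ N * (2 * N + 1) ^ S.card := hle
    _ ≤ (3 * N) * (3 * N) ^ S.card := by gcongr <;> omega
    _ = (3 * N) ^ (S.card + 1) := by rw [pow_succ, mul_comm]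
    _ ≤ (3 * N) ^ k := Nat.pow_le_pow_right (by omega) hS
    _ = _ := mul_pow _ _ _

/-- The data $(f, \varepsilon, S)$ range over a finite set depending on $k$ alone, so a union bound
suffices. -/
theorem exists_card_degenerateTuples_le {k : ℕ} (hk : 0 < k) :
    ∃ C : ℕ, ∀ N : ℕ, (degenerateTuples k N).card ≤ C * N ^ k := by
  classical
  let D := (Fin (2 * k) → Fin (2 * k)) × (Fin (2 * k) → SignType) × Finset (Fin (2 * k))
  let good : Finset D := Finset.univ.filter fun p => p.2.2.card + 1 ≤ k ∧
    IsDetermining p.1 p.2.1 p.2.2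
  refine ⟨good.card * 3 ^ k, fun N => ?_⟩
  have hsub : degenerateTuples k N ⊆ good.biUnion fun p =>
      Finset.univ.filter fun i : Fin (2 * k) → Fin N =>
        ∀ a, cyclicDiff i a = (p.2.1 a : ℤ) * cyclicDiff i (p.1 a) := by
    intro i hi
    rw [degenerateTuples, Finset.mem_filter] at hi
    obtain ⟨f, ε, S, h1, h2, h3⟩ := exists_isDetermining hk _ hi.2.1 hi.2.2
    rw [Finset.mem_biUnion]
    exact ⟨(f, ε, S), Finset.mem_filter.2 ⟨Finset.mem_univ _, h1, h3⟩,
      Finset.mem_filter.2 ⟨Finset.mem_univ _, h2⟩⟩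
  calc (degenerateTuples k N).card ≤ _ := Finset.card_le_card hsub
    _ ≤ _ := Finset.card_biUnion_le
    _ ≤ ∑ _p ∈ good, 3 ^ k * N ^ k := by
        apply Finset.sum_le_sum
        intro p hp
        have hp' := (Finset.mem_filter.1 hp).2
        exact card_le_of_isDetermining hk hp'.1 hp'.2 _ fun i hi => (Finset.mem_filter.1 hi).2
    _ = _ := by rw [Finset.sum_const, smul_eq_mul, mul_assoc]

/-! ### Trace formula for the spectral moments -/

section Trace

variable {ι : Type*} [Fintype ι]

theorem sum_fin_succ_fun {n : ℕ} (F : (Fin (n + 1) → ι) → ℝ) :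
    ∑ g, F g = ∑ x, ∑ g : Fin n → ι, F (Fin.cons x g) := by
  rw [← Fintype.sum_prod_type']
  exact (Equiv.sum_comp (Fin.consEquiv fun _ : Fin (n + 1) => ι) F).symm

variable [DecidableEq ι]

theorem pow_apply_eq_sum (A : Matrix ι ι ℝ) (n : ℕ) (u w : ι) :
    (A ^ n) u w = ∑ g : Fin (n + 1) → ι, if g 0 = u ∧ g (Fin.last n) = w then
      ∏ a : Fin n, A (g a.castSucc) (g a.succ) else 0 := by
  induction n generalizing u with
  | zero =>
    rw [sum_fin_succ_fun]
    simp [Matrix.one_apply, ite_and]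
  | succ n ih =>
    rw [pow_succ', Matrix.mul_apply, sum_fin_succ_fun]
    simp only [ih, Fin.cons_zero, ← Fin.succ_last, Fin.cons_succ, Fin.prod_univ_succ,
      Fin.castSucc_zero, ← Fin.succ_castSucc, ite_and, Finset.mul_sum, mul_ite, mul_zero]
    rw [Finset.sum_comm]
    simp only [Finset.sum_ite_eq, Finset.mem_univ, if_true]
    rw [Finset.sum_comm]
    simp

/-- The exponent $0$ is exceptional: the sum over the single empty tuple would be $1$ instead of the
dimension. -/
theorem trace_pow_eq_sum (A : Matrix ι ι ℝ) (n : ℕ) :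
    (A ^ n).trace = if n = 0 then (Fintype.card ι : ℝ) else
      ∑ g : Fin n → ι, ∏ a : Fin n, A (g a) (g (finRotate n a)) := by
  cases n with
  | zero => simp
  | succ n =>
    rw [if_neg (Nat.succ_ne_zero n), Matrix.trace]
    simp only [Matrix.diag_apply, pow_succ, Matrix.mul_apply, pow_apply_eq_sum, Finset.sum_mul]
    have : ∀ u v : ι, ∑ g : Fin (n + 1) → ι, (if g 0 = u ∧ g (Fin.last n) = v then
        ∏ a : Fin n, A (g a.castSucc) (g a.succ) else 0) * A v u =
        ∑ g : Fin (n + 1) → ι, if g 0 = u then (if g (Fin.last n) = v then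
        (∏ a : Fin n, A (g a.castSucc) (g a.succ)) * A v u else 0) else 0 := by
      intro u v
      apply Finset.sum_congr rfl
      intro g _
      rw [ite_and]
      split_ifs <;> simp
    simp only [this]
    simp only [Finset.sum_comm (s := (Finset.univ : Finset ι))
      (t := (Finset.univ : Finset (Fin (n + 1) → ι)))]
    apply Finset.sum_congr rfl
    intro g _
    rw [Finset.sum_comm]
    simp only [Finset.sum_ite_eq, Finset.mem_univ, if_true]
    rw [Fin.prod_univ_castSucc]
    simp

theorem sum_eigenvalues_pow {A : Matrix ι ι ℝ} (hA : A.IsHermitian) (m : ℕ) :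
    ∑ i, hA.eigenvalues i ^ m = (A ^ m).trace := by
  conv_rhs => rw [hA.spectral_theorem, ← map_pow, Unitary.conjStarAlgAut_apply,
    Matrix.trace_mul_comm, ← mul_assoc, Unitary.coe_star_mul_self, one_mul, Matrix.diagonal_pow,
    Matrix.trace_diagonal]
  simp

end Trace

theorem spectralMoment_eq {N : ℕ} (m : ℕ) (b : ℕ → ℝ) :
    spectralMoment m N b = (N : ℝ)⁻¹ * ((toeplitz N b ^ m).trace / Real.sqrt N ^ m) := by
  unfold spectralMoment spectralMeasure
  rw [integral_smul_measure, integral_finsetSum_measure fun i _ => integrable_dirac (by simp)]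
  simp only [integral_dirac, div_pow, ← Finset.sum_div, sum_eigenvalues_pow]
  simp

/-! ### Expectations over the ensemble -/

section Expectation

variable (p : Measure ℝ)

/-- The expectation of the product of matrix entries along a closed tuple. -/
def tupleExpectation {k N : ℕ} (i : Fin (2 * k) → Fin N) : ℝ :=
  ∫ b, ∏ a, toeplitz N b (i a) (i (next a)) ∂(Measure.infinitePi fun _ : ℕ => p)

theorem toeplitz_apply_of_ne {k N : ℕ} (i : Fin (2 * k) → Fin N) (b : ℕ → ℝ)
    (h : ∀ a, cyclicDiff i a ≠ 0) :
    ∏ a, toeplitz N b (i a) (i (next a)) = ∏ a, b (cyclicDiff i a).natAbs := by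
  apply Finset.prod_congr rfl
  intro a _
  have : i a ≠ i (next a) := by
    intro hc
    apply h a
    rw [cyclicDiff, hc, sub_self]
  rw [toeplitz, Matrix.of_apply, if_neg this, cyclicDiff]

theorem prod_toeplitz_eq_zero {k N : ℕ} (i : Fin (2 * k) → Fin N) (b : ℕ → ℝ)
    (h : ∃ a, cyclicDiff i a = 0) : ∏ a, toeplitz N b (i a) (i (next a)) = 0 := by
  obtain ⟨a, ha⟩ := h
  refine Finset.prod_eq_zero (Finset.mem_univ a) ?_
  have : i a = i (next a) := Fin.ext (by rw [cyclicDiff] at ha; omega)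
  rw [toeplitz, Matrix.of_apply, if_pos this]

theorem tupleExpectation_of_zero {k N : ℕ} (i : Fin (2 * k) → Fin N)
    (h : ∃ a, cyclicDiff i a = 0) : tupleExpectation p i = 0 := by
  simp only [tupleExpectation, prod_toeplitz_eq_zero i _ h, integral_zero]

variable [IsProbabilityMeasure p]

/-- Collecting equal entries into powers gives a product of functions of distinct, hence
independent, coordinates. Only finitely many occur, so the infinite product measure reduces to a
finite one. -/
theorem integrable_prod_entries (hp : ∀ n : ℕ, Integrable (fun x : ℝ => x ^ n) p) {n : ℕ}
    (e : Fin n → ℕ) :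
    Integrable (fun b : ℕ → ℝ => ∏ a, b (e a)) (Measure.infinitePi fun _ : ℕ => p) := by
  classical
  set s := Finset.univ.image e
  have h1 : Integrable (fun y : s → ℝ => ∏ j : s, y j ^ (Finset.univ.filter fun a => e a = j).card)
      (Measure.pi fun _ : s => p) :=
    Integrable.fintype_prod (f := fun (j : s) (x : ℝ) =>
      x ^ (Finset.univ.filter fun a => e a = j).card) fun j => hp _
  have h2 : MeasurePreserving (s.restrict (π := fun _ : ℕ => ℝ))
      (Measure.infinitePi fun _ : ℕ => p) (Measure.pi fun _ : s => p) :=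
    ⟨by fun_prop, Measure.infinitePi_map_restrict _⟩
  refine (h2.integrable_comp_of_integrable h1).congr (Eventually.of_forall fun b => ?_)
  simp only [Function.comp_apply, Finset.restrict]
  rw [Finset.prod_comp b e]
  exact Finset.prod_coe_sort s fun j => b j ^ (Finset.univ.filter fun a => e a = j).card

theorem integral_prod_entries {n : ℕ} (e : Fin n → ℕ) :
    ∫ b : ℕ → ℝ, ∏ a, b (e a) ∂(Measure.infinitePi fun _ : ℕ => p) =
      ∏ j ∈ Finset.univ.image e, ∫ x, x ^ (Finset.univ.filter fun a => e a = j).card ∂p := by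
  classical
  set s := Finset.univ.image e
  have h1 : AEStronglyMeasurable
      (fun y : s → ℝ => ∏ j : s, y j ^ (Finset.univ.filter fun a => e a = j).card)
      (Measure.pi fun _ : s => p) := by
    apply Measurable.aestronglyMeasurable
    fun_prop
  have h2 := integral_restrict_infinitePi (fun _ : ℕ => p) h1
  rw [integral_fintype_prod_eq_prod (𝕜 := ℝ) (fun (j : s) (x : ℝ) =>
    x ^ (Finset.univ.filter fun a => e a = j).card)] at h2
  rw [← Finset.prod_coe_sort, ← h2]
  congr 1
  funext b
  simp only [Finset.restrict]
  rw [Finset.prod_comp b e, ← Finset.prod_coe_sort]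

theorem integrable_prod_toeplitz (hp : ∀ n : ℕ, Integrable (fun x : ℝ => x ^ n) p) {k N : ℕ}
    (i : Fin (2 * k) → Fin N) : Integrable (fun b => ∏ a, toeplitz N b (i a) (i (next a)))
      (Measure.infinitePi fun _ : ℕ => p) := by
  by_cases h : ∃ a, cyclicDiff i a = 0
  · simp only [prod_toeplitz_eq_zero i _ h]
    exact integrable_zero _ _ _
  · push Not at h
    simp only [toeplitz_apply_of_ne i _ h]
    exact integrable_prod_entries p hp _

theorem tupleExpectation_of_ne {k N : ℕ} (i : Fin (2 * k) → Fin N)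
    (h : ∀ a, cyclicDiff i a ≠ 0) : tupleExpectation p i =
      ∏ j ∈ Finset.univ.image fun a => (cyclicDiff i a).natAbs,
        ∫ x, x ^ (Finset.univ.filter fun a => (cyclicDiff i a).natAbs = j).card ∂p := by
  simp only [tupleExpectation, toeplitz_apply_of_ne i _ h]
  exact integral_prod_entries p _

theorem exists_abs_tupleExpectation_le (k : ℕ) :
    ∃ C : ℝ, 0 ≤ C ∧ ∀ (N : ℕ) (i : Fin (2 * k) → Fin N), |tupleExpectation p i| ≤ C := by
  -- $K$ dominates every absolute moment that can occur, and the summand $1$ gives $K \ge 1$, so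
  -- fewer than $2k$ factors are also covered by $K^{2k}$.
  set K : ℝ := 1 + ∑ r ∈ Finset.range (2 * k + 1), |∫ x, x ^ r ∂p| with hK
  have hK1 : 1 ≤ K := le_add_of_nonneg_right (Finset.sum_nonneg fun _ _ => abs_nonneg _)
  refine ⟨K ^ (2 * k), by positivity, fun N i => ?_⟩
  by_cases h : ∃ a, cyclicDiff i a = 0
  · rw [tupleExpectation_of_zero p i h, abs_zero]
    positivity
  · push Not at h
    rw [tupleExpectation_of_ne p i h, Finset.abs_prod]
    refine (Finset.prod_le_prod (fun _ _ => abs_nonneg _) (g := fun _ => K) ?_).trans ?_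
    · intro j _
      refine le_trans ?_ (le_add_of_nonneg_left zero_le_one)
      refine Finset.single_le_sum (f := fun r => |∫ x, x ^ r ∂p|) (fun _ _ => abs_nonneg _) ?_
      rw [Finset.mem_range]
      have := Finset.card_filter_le Finset.univ fun a : Fin (2 * k) =>
        (cyclicDiff i a).natAbs = j
      rw [Finset.card_univ, Fintype.card_fin] at this
      omega
    · rw [Finset.prod_const]
      apply pow_le_pow_right₀ hK1
      refine Finset.card_image_le.trans ?_
      simp

/-- The number of pairings which match the tuple `i`. -/
def matchCount {k N : ℕ} (i : Fin (2 * k) → Fin N) : ℕ :=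
  (Finset.univ.filter fun π : Pairing k => i ∈ matchedTuples π N).card

theorem matchCount_le {k N : ℕ} (i : Fin (2 * k) → Fin N) :
    matchCount i ≤ Fintype.card (Pairing k) := Finset.card_le_univ _

theorem natAbs_cyclicDiff_of_mem {k N : ℕ} {π : Pairing k} {i : Fin (2 * k) → Fin N}
    (h : i ∈ matchedTuples π N) (a : Fin (2 * k)) :
    (cyclicDiff i (π.1 a)).natAbs = (cyclicDiff i a).natAbs := by
  rw [mem_matchedTuples.1 h a, Int.natAbs_neg]

/-- If the matching is exact, each entry occurs exactly twice, so unit variance gives $1$, and the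
matching pairing is unique. Otherwise some absolute difference occurs once: no pairing matches, and
the expectation vanishes through a mean-zero factor or a diagonal zero. -/
theorem tupleExpectation_eq_matchCount (h1 : ∫ x, x ∂p = 0) (h2 : ∫ x, x ^ 2 ∂p = 1) {k N : ℕ}
    {i : Fin (2 * k) → Fin N} (hi : i ∉ degenerateTuples k N) :
    tupleExpectation p i = matchCount i := by
  classical
  rw [degenerateTuples, Finset.mem_filter, not_and, not_and, not_not] at hi
  by_cases hrep : ∀ a, ∃ b, b ≠ a ∧ (cyclicDiff i b).natAbs = (cyclicDiff i a).natAbs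
  · obtain ⟨π, hopp, hne, hex⟩ := hi (Finset.mem_univ _) hrep
    have hmem : i ∈ matchedTuples π N := mem_matchedTuples.2 hopp
    have hcount : matchCount i = 1 := by
      rw [matchCount, Finset.card_eq_one]
      refine ⟨π, ?_⟩
      ext π'
      simp only [Finset.mem_filter, Finset.mem_univ, true_and, Finset.mem_singleton]
      constructor
      · intro h
        apply Subtype.ext
        ext a : 1
        exact (hex a _ (natAbs_cyclicDiff_of_mem h a)).resolve_left (π'.apply_ne a)
      · rintro rfl; exact hmem
    rw [hcount, Nat.cast_one, tupleExpectation_of_ne p i hne]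
    apply Finset.prod_eq_one
    intro j hj
    obtain ⟨a, -, rfl⟩ := Finset.mem_image.1 hj
    have : (Finset.univ.filter fun b => (cyclicDiff i b).natAbs = (cyclicDiff i a).natAbs)
        = {a, π.1 a} := by
      ext b
      simp only [Finset.mem_filter, Finset.mem_univ, true_and, Finset.mem_insert,
        Finset.mem_singleton]
      constructor
      · exact hex a b
      · rintro (rfl | rfl)
        · rfl
        · exact natAbs_cyclicDiff_of_mem hmem a
    rw [this, Finset.card_pair (π.apply_ne a).symm, h2]
  · push Not at hrep
    obtain ⟨a, ha⟩ := hrep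
    have hcount : matchCount i = 0 := by
      rw [matchCount, Finset.card_eq_zero, Finset.filter_eq_empty_iff]
      intro π _ h
      exact ha _ (π.apply_ne a) (natAbs_cyclicDiff_of_mem h a)
    rw [hcount, Nat.cast_zero]
    by_cases h : ∃ a, cyclicDiff i a = 0
    · exact tupleExpectation_of_zero p i h
    · push Not at h
      rw [tupleExpectation_of_ne p i h]
      refine Finset.prod_eq_zero (Finset.mem_image_of_mem _ (Finset.mem_univ a)) ?_
      have : (Finset.univ.filter fun b => (cyclicDiff i b).natAbs = (cyclicDiff i a).natAbs)
          = {a} := by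
        ext b
        simp only [Finset.mem_filter, Finset.mem_univ, true_and, Finset.mem_singleton]
        constructor
        · intro hb
          by_contra hba
          exact ha b hba hb
        · rintro rfl; rfl
      rw [this, Finset.card_singleton]
      simpa using h1

theorem averageMoment_eq (hp : ∀ n : ℕ, Integrable (fun x : ℝ => x ^ n) p) {k : ℕ} (hk : 0 < k)
    (N : ℕ) : averageMoment p (2 * k) N =
      (∑ i : Fin (2 * k) → Fin N, tupleExpectation p i) / (N : ℝ) ^ (k + 1) := by
  have h : ∀ b, spectralMoment (2 * k) N b =
      (∑ i : Fin (2 * k) → Fin N, ∏ a, toeplitz N b (i a) (i (next a))) / (N : ℝ) ^ (k + 1) := by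
    intro b
    rw [spectralMoment_eq, trace_pow_eq_sum, if_neg (by omega), pow_mul,
      Real.sq_sqrt (Nat.cast_nonneg N), pow_succ, inv_mul_eq_div, div_div]
  simp only [averageMoment, h]
  rw [integral_div, integral_finsetSum _ fun i _ => integrable_prod_toeplitz p hp i]
  rfl

theorem sum_contribution_eq (k N : ℕ) : ∑ π : Pairing k, contribution π N =
    (∑ i : Fin (2 * k) → Fin N, (matchCount i : ℝ)) / (N : ℝ) ^ (k + 1) := by
  classical
  simp only [contribution]
  rw [← Finset.sum_div]
  congr 1
  have h := Finset.sum_card_bipartiteAbove_eq_sum_card_bipartiteBelow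
    (s := (Finset.univ : Finset (Pairing k)))
    (t := (Finset.univ : Finset (Fin (2 * k) → Fin N))) (fun π i => i ∈ matchedTuples π N)
  have h3 : ∀ π : Pairing k, Finset.bipartiteAbove (fun π i => i ∈ matchedTuples π N)
      Finset.univ π = matchedTuples π N := by
    intro π; ext i; simp [Finset.bipartiteAbove]
  simp only [h3] at h
  exact_mod_cast h

/-- The two sums differ only on degenerate tuples: $O(N^k)$ of them, with bounded terms, against the
normalization $N^{k+1}$. -/
theorem tendsto_averageMoment_sub (hp : ∀ n : ℕ, Integrable (fun x : ℝ => x ^ n) p)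
    (h1 : ∫ x, x ∂p = 0) (h2 : ∫ x, x ^ 2 ∂p = 1) {k : ℕ} (hk : 0 < k) :
    Tendsto (fun N : ℕ => averageMoment p (2 * k) N - ∑ π : Pairing k, contribution π N) atTop
      (𝓝 0) := by
  obtain ⟨C, hC, hexp⟩ := exists_abs_tupleExpectation_le p k
  obtain ⟨B, hB⟩ := exists_card_degenerateTuples_le hk
  set D : ℝ := C + Fintype.card (Pairing k) with hD
  refine squeeze_zero_norm' (a := fun N : ℕ => D * B / N) ?_
    (tendsto_const_div_atTop_nhds_zero_nat _)
  filter_upwards [eventually_gt_atTop 0] with N hN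
  have hN' : (0 : ℝ) < N := by exact_mod_cast hN
  rw [averageMoment_eq p hp hk, sum_contribution_eq, ← sub_div, ← Finset.sum_sub_distrib,
    Real.norm_eq_abs, abs_div, abs_of_nonneg (by positivity : (0 : ℝ) ≤ (N : ℝ) ^ (k + 1)),
    div_le_div_iff₀ (by positivity) hN']
  have hsum : ∑ i : Fin (2 * k) → Fin N, (tupleExpectation p i - matchCount i)
      = ∑ i ∈ degenerateTuples k N, (tupleExpectation p i - matchCount i) := by
    symm
    apply Finset.sum_subset (Finset.subset_univ _)
    intro i _ hi
    rw [tupleExpectation_eq_matchCount p h1 h2 hi, sub_self]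
  have hle : |∑ i : Fin (2 * k) → Fin N, (tupleExpectation p i - matchCount i)|
      ≤ D * (B * (N : ℝ) ^ k) := by
    rw [hsum]
    calc _ ≤ ∑ i ∈ degenerateTuples k N, |tupleExpectation p i - matchCount i| :=
          Finset.abs_sum_le_sum_abs _ _
      _ ≤ ∑ _i ∈ degenerateTuples k N, D := by
          apply Finset.sum_le_sum
          intro i _
          refine (abs_sub _ _).trans (add_le_add (hexp N i) ?_)
          rw [Nat.abs_cast]
          exact_mod_cast matchCount_le i
      _ = D * (degenerateTuples k N).card := by rw [Finset.sum_const, nsmul_eq_mul, mul_comm]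
      _ ≤ D * (B * (N : ℝ) ^ k) := by
          gcongr
          exact_mod_cast hB N
  calc _ ≤ D * (B * (N : ℝ) ^ k) * N := by gcongr
    _ = _ := by rw [pow_succ]; ring

theorem averageMoment_zero {N : ℕ} (hN : 0 < N) : averageMoment p 0 N = 1 := by
  have hN' : (N : ℝ) ≠ 0 := by exact_mod_cast hN.ne'
  simp only [averageMoment, spectralMoment_eq, trace_pow_eq_sum]
  simp [hN']

end Expectation

/-! ### Limiting moments and comparison with the Gaussian -/

/-- The limiting contribution of a pairing. -/
def limitContribution {k : ℕ} (π : Pairing k) : ℝ := (exists_tendsto_contribution π).choose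

theorem tendsto_contribution {k : ℕ} (π : Pairing k) :
    Tendsto (fun N : ℕ => contribution π N) atTop (𝓝 (limitContribution π)) :=
  (exists_tendsto_contribution π).choose_spec

theorem limitContribution_nonneg {k : ℕ} (π : Pairing k) : 0 ≤ limitContribution π :=
  ge_of_tendsto' (tendsto_contribution π) fun N => by unfold contribution; positivity

theorem limitContribution_le {k c : ℕ} {π : Pairing k} (h : HasObstructions π c) :
    limitContribution π ≤ (2 / 3) ^ c :=
  limit_contribution_le h (tendsto_contribution π)

/-- The limiting even moments. -/
def limitMoment (k : ℕ) : ℝ := if k = 0 then 1 else ∑ π : Pairing k, limitContribution π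

theorem tendsto_averageMoment (p : Measure ℝ) [IsProbabilityMeasure p]
    (hp : ∀ n : ℕ, Integrable (fun x : ℝ => x ^ n) p) (h1 : ∫ x, x ∂p = 0)
    (h2 : ∫ x, x ^ 2 ∂p = 1) (k : ℕ) :
    Tendsto (fun N : ℕ => averageMoment p (2 * k) N) atTop (𝓝 (limitMoment k)) := by
  rcases Nat.eq_zero_or_pos k with rfl | hk
  · rw [limitMoment, if_pos rfl]
    refine tendsto_const_nhds.congr' ?_
    filter_upwards [eventually_gt_atTop 0] with N hN
    exact (averageMoment_zero p hN).symm
  · rw [limitMoment, if_neg hk.ne']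
    have h := (tendsto_averageMoment_sub p hp h1 h2 hk).add
      (tendsto_finsetSum Finset.univ fun (π : Pairing k) _ => tendsto_contribution π)
    simpa using h

/-- Pairings with $c$ obstructions contribute at most $(2/3)^c$ on average, and the others form a
vanishing proportion. First $c$ is fixed to make the power small, then $k$ grows. -/
theorem tendsto_limitMoment_div :
    Tendsto (fun k : ℕ => limitMoment k / ((2 * k - 1)‼ : ℝ)) atTop (𝓝 0) := by
  classical
  have hpos : ∀ k : ℕ, (0 : ℝ) < ((2 * k - 1)‼ : ℕ) := fun k => by
    exact_mod_cast Nat.doubleFactorial_pos _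
  have hnonneg : ∀ k : ℕ, 0 ≤ limitMoment k := by
    intro k
    unfold limitMoment
    split_ifs
    · exact zero_le_one
    · exact Finset.sum_nonneg fun π _ => limitContribution_nonneg π
  have hle : ∀ c k : ℕ, 0 < k → limitMoment k / ((2 * k - 1)‼ : ℝ) ≤ (2 / 3) ^ c +
      (1 - (Nat.card {π : Pairing k // HasObstructions π c} : ℝ) / ((2 * k - 1)‼ : ℝ)) := by
    intro c k hk
    have h1 : limitMoment k ≤ ∑ π : Pairing k,
        ((2 / 3 : ℝ) ^ c + (1 - if HasObstructions π c then 1 else 0)) := by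
      rw [limitMoment, if_neg hk.ne']
      apply Finset.sum_le_sum
      intro π _
      split_ifs with h
      · rw [sub_self, add_zero]
        exact limitContribution_le h
      -- Zero obstructions are always present, which gives the trivial bound $1$ on a contribution.
      · have := limitContribution_le (hasObstructions_zero π)
        rw [pow_zero] at this
        have h3 : (0 : ℝ) ≤ (2 / 3) ^ c := by positivity
        linarith
    rw [Finset.sum_add_distrib, Finset.sum_sub_distrib, Finset.sum_const, Finset.sum_const,
      Finset.sum_boole, Finset.card_univ, card_pairing, nsmul_eq_mul, nsmul_eq_mul, mul_one,
      ← Fintype.card_subtype, ← Nat.card_eq_fintype_card] at h1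
    rw [div_le_iff₀ (hpos k), add_mul, sub_mul, div_mul_cancel₀ _ (hpos k).ne', one_mul]
    linarith
  rw [Metric.tendsto_atTop]
  intro δ hδ
  obtain ⟨c, hc⟩ := exists_pow_lt_of_lt_one (half_pos hδ) (by norm_num : (2 / 3 : ℝ) < 1)
  have hprop := (tendsto_proportion_hasObstructions c).const_sub 1
  rw [sub_self] at hprop
  obtain ⟨K, hK⟩ := eventually_atTop.1 (hprop.eventually_lt_const (half_pos hδ))
  refine ⟨max K 1, fun k hk => ?_⟩
  rw [Real.dist_eq, sub_zero, abs_of_nonneg (div_nonneg (hnonneg k) (hpos k).le)]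
  have h1 := hle c k (le_trans (le_max_right _ _) hk)
  have h2 := hK k (le_trans (le_max_left _ _) hk)
  linarith

end RandomToeplitz

end

theorem mainTheorem4 :
    ∃ (M : ℕ → ℝ) (v : ∀ k : ℕ, RandomToeplitz.Pairing k → ℝ),
      -- `M k` is the limiting `2k`-th moment `M_{2k}`, the same for every admissible law `p`
      (∀ (p : Measure ℝ) [IsProbabilityMeasure p],
        (∀ n : ℕ, Integrable (fun x : ℝ => x ^ n) p) →
        ∫ x, x ∂p = 0 → ∫ x, x ^ 2 ∂p = 1 →
        ∀ k : ℕ, Tendsto (fun N : ℕ => RandomToeplitz.averageMoment p (2 * k) N) atTop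
          (𝓝 (M k))) ∧
      -- the ratio to the Gaussian moment tends to `0`
      Tendsto (fun k : ℕ => M k / ((2 * k - 1)‼ : ℝ)) atTop (𝓝 0) ∧
      -- `v k π` is the limiting contribution of the pairing `π`, and these add up to `M_{2k}`
      (∀ (k : ℕ) (π : RandomToeplitz.Pairing k),
        Tendsto (fun N : ℕ => RandomToeplitz.contribution π N) atTop (𝓝 (v k π))) ∧
      (∀ k : ℕ, 1 ≤ k → M k = ∑ π : RandomToeplitz.Pairing k, v k π) ∧
      -- almost all pairings carry at least `c` independent obstructions
      (∀ c : ℕ, Tendsto (fun k : ℕ =>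
        (Nat.card {π : RandomToeplitz.Pairing k // RandomToeplitz.HasObstructions π c} : ℝ)
          / ((2 * k - 1)‼ : ℝ)) atTop (𝓝 1)) ∧
      -- each obstruction costs a factor `2 / 3`
      (∀ (c k : ℕ) (π : RandomToeplitz.Pairing k), RandomToeplitz.HasObstructions π c →
        v k π ≤ (2 / 3 : ℝ) ^ c) := by
  open RandomToeplitz in
  refine ⟨limitMoment, fun _ => limitContribution, ?_, tendsto_limitMoment_div,
    fun _ => tendsto_contribution, ?_, tendsto_proportion_hasObstructions,
    fun _ _ _ => limitContribution_le⟩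
  · intro p _ hp h1 h2 k
    exact tendsto_averageMoment p hp h1 h2 k
  · intro k hk
    rw [limitMoment, if_neg (by omega)]
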